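/- For $n\ge 1$ let $B_n$ be the hyperoctahedral group, i.e. the group of permutations $\pi$ of $\{\pm1,\dots,\pm n\}$ with $\pi(-a)=-\pi(a)$ for all $a$; write $\pi=[\pi(1),\dots,\pi(n)]$. Let $S=\{s_0,s_1,\dots,s_{n-1}\}$ with $s_0=(1,-1)$ and $s_i=(i,i+1)(-i,-(i+1))$ for $1\le i\le n-1$ be its Coxeter generators, let $\ell(w)$ be the least $k$ such that $w$ is a product of $k$ elements of $S$, and let $T=\{wsw^{-1}: w\in B_n,\ s\in S\}$ be the set of reflections. The (strong) Bruhat order on $B_n$ is the partial order in which $u\le v$ if and only if there is a chain $u=w_0,w_1,\dots,w_k=v$ ($k\ge 0$) with $w_{i-1}w_i^{-1}\in T$ and $\ell(w_{i-1})<\ell(w_i)$ for $1\le i\le k$. Its Hasse diagram $H(B_n)$ is the undirected graph with vertex set $B_n$ in which two elements are adjacent if and only if one of them covers the other in the Bruhat order. **Theorem.** For every $n\ge 5$, the maximum degree of a vertex of $H(B_n)$ is $$\left\lfloor \frac{n^2}{2}\right\rfloor+n-1 .$$ Moreover, with $m=\lfloor n/2\rfloor$, this maximum is attained at the vertex $[1,2,\dots,m,-n,-(n-1),\dots,-(m+1)]$.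 -/

import Mathlib

section BruhatOrder

variable {W : Type*} [Group W]

/-- The length of `w` with respect to a set `S` of (involutive) generators: the least number of
factors in an expression of `w` as a product of elements of `S`. -/
noncomputable def wordLength (S : Set W) (w : W) : ℕ :=
  sInf {k : ℕ | ∃ l : List W, (∀ s ∈ l, s ∈ S) ∧ l.prod = w ∧ l.length = k}

/-- The reflections of `(W, S)`: the conjugates of the elements of `S`. -/
def reflections (S : Set W) : Set W :=
  {t : W | ∃ w : W, ∃ s ∈ S, t = w * s * w⁻¹}

/-- `BruhatStep S u v` says `u → v`: `u = t * v` for a reflection `t`, and `u` is shorter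
than `v`. -/
def BruhatStep (S : Set W) (u v : W) : Prop :=
  ∃ t ∈ reflections S, u = t * v ∧ wordLength S u < wordLength S v

/-- `u ≤ v` in the Bruhat order: there is a (possibly empty) chain `u → ⋯ → v`. -/
def BruhatLE (S : Set W) (u v : W) : Prop :=
  Relation.ReflTransGen (BruhatStep S) u v

theorem BruhatLE.eq_or_length_lt {S : Set W} {u v : W} (h : BruhatLE S u v) :
    u = v ∨ wordLength S u < wordLength S v := by
  induction h with
  | refl => exact Or.inl rfl
  | tail _ hstep ih =>
    obtain ⟨_, _, _, hlt⟩ := hstep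
    rcases ih with rfl | ih
    · exact Or.inr hlt
    · exact Or.inr (ih.trans hlt)

/-- The (strong) Bruhat order of `(W, S)`. -/
@[reducible] def bruhatOrder (S : Set W) : PartialOrder W where
  le := BruhatLE S
  le_refl _ := Relation.ReflTransGen.refl
  le_trans _ _ _ h₁ h₂ := Relation.ReflTransGen.trans h₁ h₂
  le_antisymm u v h₁ h₂ := by
    rcases h₁.eq_or_length_lt with h | h
    · exact h
    · rcases h₂.eq_or_length_lt with h' | h'
      · exact h'.symm
      · exact absurd h (lt_asymm h')

end BruhatOrder

/-- The set `{±1, …, ±n}`. -/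
abbrev SignedIndex (n : ℕ) : Type := {a : ℤ // a ≠ 0 ∧ |a| ≤ (n : ℤ)}

namespace SignedIndex

variable {n : ℕ}

instance : Neg (SignedIndex n) := ⟨fun a => ⟨-a.1, by simpa using a.2⟩⟩

@[simp] theorem coe_neg (a : SignedIndex n) : ((-a : SignedIndex n) : ℤ) = -(a : ℤ) := rfl

instance : InvolutiveNeg (SignedIndex n) where
  neg_neg a := Subtype.ext (neg_neg a.1)

instance : Finite (SignedIndex n) :=
  ((Set.finite_Icc (-(n : ℤ)) n).subset (fun _ ha => abs_le.mp ha.2)).to_subtype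

theorem neg_ne_self (a : SignedIndex n) : -a ≠ a := by
  intro h
  have h1 : -(a : ℤ) = a := congrArg Subtype.val h
  exact a.2.1 (by omega)

end SignedIndex

/-- The hyperoctahedral group `B_n`: the permutations `π` of `{±1, …, ±n}` with
`π (-a) = -π a` for all `a`. -/
def hyperoctahedralGroup (n : ℕ) : Subgroup (Equiv.Perm (SignedIndex n)) where
  carrier := {π | ∀ a, π (-a) = -π a}
  one_mem' _ := rfl
  mul_mem' {π σ} hπ hσ a := by
    rw [Equiv.Perm.mul_apply, hσ a, hπ (σ a), Equiv.Perm.mul_apply]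
  inv_mem' {π} hπ a := by
    rw [Equiv.Perm.inv_eq_iff_eq, hπ]
    simp

/-- The type of elements of `B_n`. -/
abbrev Hyperoctahedral (n : ℕ) : Type := hyperoctahedralGroup n

namespace Hyperoctahedral

variable {n : ℕ}

theorem swap_neg_mem (a : SignedIndex n) :
    Equiv.swap a (-a) ∈ hyperoctahedralGroup n := by
  intro c
  by_cases h1 : c = a
  · subst h1; simp
  · by_cases h2 : c = -a
    · subst h2; simp
    · have h3 : -c ≠ a := fun h => h2 (by rw [← h, neg_neg])
      have h4 : -c ≠ -a := fun h => h1 (neg_injective h)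
      rw [Equiv.swap_apply_of_ne_of_ne h3 h4, Equiv.swap_apply_of_ne_of_ne h1 h2]

theorem swap_mul_swap_mem (a b : SignedIndex n) :
    Equiv.swap a b * Equiv.swap (-a) (-b) ∈ hyperoctahedralGroup n := by
  intro c
  have ha := SignedIndex.neg_ne_self a
  have hb := SignedIndex.neg_ne_self b
  have hc := SignedIndex.neg_ne_self c
  simp only [Equiv.Perm.mul_apply, Equiv.swap_apply_def]
  have e1 : ∀ x y : SignedIndex n, -x = -y ↔ x = y := fun _ _ => neg_inj
  have e2 : ∀ x y : SignedIndex n, -x = y ↔ x = -y := fun _ _ => neg_eq_iff_eq_neg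
  grind [neg_neg]

/-- The signed permutation `(a, -a)`. -/
def signChange (a : SignedIndex n) : Hyperoctahedral n :=
  ⟨Equiv.swap a (-a), swap_neg_mem a⟩

/-- The signed permutation `(a, b)(-a, -b)`. -/
def signedSwap (a b : SignedIndex n) : Hyperoctahedral n :=
  ⟨Equiv.swap a b * Equiv.swap (-a) (-b), swap_mul_swap_mem a b⟩

/-- The Coxeter generators of `B_n`: `s₀ = (1, -1)` and `s_i = (i, i+1)(-i, -(i+1))` for
`1 ≤ i ≤ n - 1`. -/
def generators (n : ℕ) : Set (Hyperoctahedral n) :=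
  {s | ∃ a : SignedIndex n, (a : ℤ) = 1 ∧ s = signChange a} ∪
  {s | ∃ a b : SignedIndex n, 0 < (a : ℤ) ∧ (b : ℤ) = (a : ℤ) + 1 ∧ s = signedSwap a b}

/-- `B_n` is ordered by its Bruhat order. -/
instance : PartialOrder (Hyperoctahedral n) := bruhatOrder (generators n)

noncomputable instance : Fintype (Hyperoctahedral n) := Fintype.ofFinite _

/-- The Hasse diagram `H(B_n)` of the Bruhat order: two elements are adjacent if and only if one
of them covers the other. -/
abbrev hasseDiagram (n : ℕ) : SimpleGraph (Hyperoctahedral n) :=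
  SimpleGraph.hasse (Hyperoctahedral n)

end Hyperoctahedral

/-! Draw a signed permutation `π` as the centrally symmetric set of points `(k, π k)`, so that it
becomes an odd injective function `h` over `±A` with `A = {1, …, n}`. Multiplying by a reflection
exchanges the heights over `i, j` and over `-i, -j`. The count of inversions over `±A` plus the
number of negative values over `A` is twice the length. It rises by exactly 2 when the box spanned
by the two points is empty and, unless `j = -i`, does not contain the origin. If the box fails these
conditions, an explicit chain of three Bruhat steps shows that there is no cover. So the degree of
`π` is the number of linked pairs up to sign (`adj_mul_pairReflection_iff`,
`degree_eq_card_linkPairs`), and the rest is plane combinatorics.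

Put `f n = ⌊n²/2⌋ + n - 1`. Then `f n - f (n - 1)` is `n + 1` for even `n` and `n` for odd `n`, and
`f n - f (n - 2) = 2 n` for odd `n`. Deleting points only makes boxes emptier, so induction reduces
the upper bound to finding a point with few neighbours, or two points with few neighbours together
(`card_linkPairs_step`). The base case of five points is a finite check on relative orders.

For the step, take consecutive positions `p < q` whose heights differ the most. A discrete
intermediate value argument places their common neighbours: apart from one degenerate case, such a
neighbour has height between `h p` and `h q`, and there is at most one on each side (`common_cases`,
`common_right_unique`). By inclusion–exclusion `p` and `q` then have at most `2 n` neighbours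
together, unless the configuration is `Exceptional` or the gap is at most `|h u|`, where `u` is the
leftmost position. An exceptional gap is below `2 |h u|`, so whenever the bound fails all gaps are
below `2 |h u|`. In that case `u` has at most `n + 1` neighbours (`card_linkNbrs_min_le`), which is
enough for even `n`. For odd `n`, equality forces an exceptional pair with `p = u`, a configuration
so rigid that some other point has at most `n` neighbours (`Exceptional.exists_card_linkNbrs_le`).

For the lower bound, in `[1, …, m, -n, …, -(m+1)]` each of the `2 m` points over `±1, …, ±m` is
linked to each of the `n - m` points to the right of `m`. Adjacent positions and the pair `(-1, 1)`
supply `n - 1` further links. -/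

/-! ### Linked pairs in a centrally symmetric point set. -/

/-- The point `(k, h k)` lies strictly inside the box spanned by `(p, h p)` and `(r, h r)`. -/
def InBox (h : ℤ → ℤ) (p r k : ℤ) : Prop :=
  ((p < k ∧ k < r) ∨ (r < k ∧ k < p)) ∧
    ((h p < h k ∧ h k < h r) ∨ (h r < h k ∧ h k < h p))

/-- No point over `±A` lies strictly inside the box spanned by the points over `p` and `r`. -/
def EmptyBox (h : ℤ → ℤ) (A : Finset ℤ) (p r : ℤ) : Prop :=
  ∀ k, (k ∈ A ∨ -k ∈ A) → ¬ InBox h p r k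

/-- The points over `p` and `r` lie in opposite open quadrants. -/
def Central (h : ℤ → ℤ) (p r : ℤ) : Prop :=
  ((p < 0 ∧ 0 < r) ∨ (r < 0 ∧ 0 < p)) ∧ ((h p < 0 ∧ 0 < h r) ∨ (h r < 0 ∧ 0 < h p))

/-- The points over `p` and `r` span an empty box which is either symmetric about the origin or
does not contain the origin. -/
def Linked (h : ℤ → ℤ) (A : Finset ℤ) (p r : ℤ) : Prop :=
  p ≠ r ∧ (r = -p ∨ ¬ Central h p r) ∧ EmptyBox h A p r

/-- The set `A ∪ -A`. -/
def signedPoints (A : Finset ℤ) : Finset ℤ := A ∪ A.image (fun a => -a)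

open Classical in
/-- The linked pairs over `±A`, one for each pair of opposite pairs. -/
noncomputable def linkPairs (h : ℤ → ℤ) (A : Finset ℤ) : Finset (ℤ × ℤ) :=
  (signedPoints A ×ˢ signedPoints A).filter
    (fun x => x.1 < x.2 ∧ 0 ≤ x.1 + x.2 ∧ Linked h A x.1 x.2)

open Classical in
/-- The points of `±A` linked to `p`. -/
noncomputable def linkNbrs (h : ℤ → ℤ) (A : Finset ℤ) (p : ℤ) : Finset ℤ :=
  (signedPoints A).filter (Linked h A p)

/-- `p < q` are consecutive elements of `A`. -/
def Consecutive (A : Finset ℤ) (p q : ℤ) : Prop :=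
  p ∈ A ∧ q ∈ A ∧ p < q ∧ ∀ k ∈ A, ¬ (p < k ∧ k < q)

section LinkBasics

variable {h : ℤ → ℤ} {A B : Finset ℤ} {p q r k : ℤ}

theorem mem_signedPoints : k ∈ signedPoints A ↔ k ∈ A ∨ -k ∈ A := by
  simp only [signedPoints, Finset.mem_union, Finset.mem_image]
  constructor
  · rintro (h | ⟨a, ha, rfl⟩)
    · exact Or.inl h
    · right; simpa using ha
  · rintro (h | h)
    · exact Or.inl h
    · exact Or.inr ⟨-k, h, by simp⟩

theorem neg_mem_signedPoints (hk : k ∈ signedPoints A) : -k ∈ signedPoints A := by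
  rw [mem_signedPoints] at *
  rw [neg_neg]; tauto

theorem mem_linkNbrs : r ∈ linkNbrs h A p ↔ r ∈ signedPoints A ∧ Linked h A p r := by
  simp [linkNbrs]

theorem mem_linkPairs {x : ℤ × ℤ} : x ∈ linkPairs h A ↔
    x.1 ∈ signedPoints A ∧ x.2 ∈ signedPoints A ∧ x.1 < x.2 ∧ 0 ≤ x.1 + x.2 ∧
      Linked h A x.1 x.2 := by
  simp [linkPairs, and_assoc]

theorem card_signedPoints (hpos : ∀ a ∈ A, 0 < a) : (signedPoints A).card = 2 * A.card := by
  rw [signedPoints, Finset.card_union_of_disjoint,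
    Finset.card_image_of_injective _ neg_injective, two_mul]
  rw [Finset.disjoint_left]
  intro a ha ha'
  obtain ⟨b, hb, rfl⟩ := Finset.mem_image.1 ha'
  have := hpos _ ha
  have := hpos _ hb
  omega

theorem Linked.symm (hl : Linked h A p r) : Linked h A r p := by
  obtain ⟨h1, h2, h3⟩ := hl
  refine ⟨h1.symm, ?_, fun k hk hb => h3 k hk ?_⟩
  · rcases h2 with h2 | h2
    · left; omega
    · right; unfold Central at *; tauto
  · unfold InBox at *; tauto

theorem Linked.neg (hodd : ∀ k, h (-k) = -h k) (hl : Linked h A p r) :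
    Linked h A (-p) (-r) := by
  obtain ⟨h1, h2, h3⟩ := hl
  refine ⟨fun e => h1 (neg_injective e), ?_, fun k hk hb => h3 (-k) ?_ ?_⟩
  · rcases h2 with h2 | h2
    · left; omega
    · right; unfold Central at *; rw [hodd, hodd]; omega
  · rw [neg_neg]; tauto
  · unfold InBox at *
    rw [hodd] at *
    rw [hodd] at hb
    omega

/-- Reflection in the horizontal axis preserves boxes and opposite quadrants. This is what allows
the sign of one height to be normalised in the later arguments. -/
theorem Linked.flip (hl : Linked h A p r) : Linked (fun k => -h k) A p r := by
  obtain ⟨h1, h2, h3⟩ := hl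
  refine ⟨h1, ?_, fun k hk hb => h3 k hk ?_⟩
  · rcases h2 with h2 | h2
    · left; omega
    · right; unfold Central at *; beta_reduce; omega
  · unfold InBox at *; beta_reduce at hb; omega

theorem linked_flip : Linked (fun k => -h k) A p r ↔ Linked h A p r := by
  refine ⟨fun hl => ?_, Linked.flip⟩
  simpa using hl.flip

theorem linkNbrs_flip : linkNbrs (fun k => -h k) A p = linkNbrs h A p := by
  ext; simp [mem_linkNbrs, linked_flip]

theorem linkPairs_flip : linkPairs (fun k => -h k) A = linkPairs h A := by
  ext; simp [mem_linkPairs, linked_flip]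

theorem Linked.mono (hAB : B ⊆ A) (hl : Linked h A p r) : Linked h B p r :=
  ⟨hl.1, hl.2.1, fun k hk => hl.2.2 k (hk.imp (@hAB _) (@hAB _))⟩

theorem Linked.not_between (hl : Linked h A p r) (hk : k ∈ A) :
    ¬ (((p < k ∧ k < r) ∨ (r < k ∧ k < p)) ∧
      ((h p < h k ∧ h k < h r) ∨ (h r < h k ∧ h k < h p))) :=
  hl.2.2 k (Or.inl hk)

theorem Linked.not_between_neg (hodd : ∀ k, h (-k) = -h k) (hl : Linked h A p r) (hk : k ∈ A) :
    ¬ (((p < -k ∧ -k < r) ∨ (r < -k ∧ -k < p)) ∧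
      ((h p < -h k ∧ -h k < h r) ∨ (h r < -h k ∧ -h k < h p))) := by
  rw [← hodd]
  exact hl.2.2 (-k) (Or.inr (by simpa using hk))

/-- The canonical representative of the pair formed by `p > 0` and `r`. -/
def pairWith (p r : ℤ) : ℤ × ℤ :=
  if r < -p then (-p, -r) else if r < p then (r, p) else (p, r)

/-- Each linked pair that involves `p` or `-p` is recovered from a neighbour of `p`, after a change
of sign if necessary. Hence removing `±p` destroys at most as many pairs as `p` has neighbours. -/
theorem mem_pairWith_image (hodd : ∀ k, h (-k) = -h k) (hpos : ∀ a ∈ A, 0 < a)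
    (hp : p ∈ A) {x : ℤ × ℤ} (hx : x ∈ linkPairs h A)
    (hxp : x.1 = p ∨ x.1 = -p ∨ x.2 = p ∨ x.2 = -p) :
    ∃ r ∈ linkNbrs h A p, pairWith p r = x ∧ (r = x.1 ∨ r = -x.1 ∨ r = x.2 ∨ r = -x.2) ∧
      (r = -p → x = (-p, p)) := by
  obtain ⟨i, j⟩ := x
  rw [mem_linkPairs] at hx
  obtain ⟨hi, hj, hij, hs, hl⟩ := hx
  have hp0 := hpos p hp
  simp only at *
  rcases hxp with h1 | h1 | h1 | h1
  · subst h1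
    exact ⟨j, mem_linkNbrs.2 ⟨hj, hl⟩, by unfold pairWith; split_ifs <;> first | rfl | omega,
      by tauto, by omega⟩
  · subst h1
    have hl' := hl.neg hodd
    rw [neg_neg] at hl'
    refine ⟨-j, mem_linkNbrs.2 ⟨neg_mem_signedPoints hj, hl'⟩, ?_, by tauto, ?_⟩
    · unfold pairWith
      split_ifs
      · simp
      · simp; omega
      · omega
    · intro e; simp; omega
  · subst h1
    refine ⟨i, mem_linkNbrs.2 ⟨hi, hl.symm⟩, ?_, by tauto, ?_⟩
    · unfold pairWith; split_ifs <;> first | rfl | omega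
    · intro e; simp; omega
  · omega

theorem card_linkPairs_le_erase (hodd : ∀ k, h (-k) = -h k) (hpos : ∀ a ∈ A, 0 < a)
    (hp : p ∈ A) :
    (linkPairs h A).card ≤ (linkPairs h (A.erase p)).card + (linkNbrs h A p).card := by
  have hsub : linkPairs h A ⊆ linkPairs h (A.erase p) ∪ (linkNbrs h A p).image (pairWith p) := by
    intro x hx
    rw [Finset.mem_union]
    by_cases hxp : x.1 = p ∨ x.1 = -p ∨ x.2 = p ∨ x.2 = -p
    · right
      obtain ⟨r, hr, e, -⟩ := mem_pairWith_image hodd hpos hp hx hxp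
      exact Finset.mem_image.2 ⟨r, hr, e⟩
    · left
      rw [mem_linkPairs] at hx ⊢
      obtain ⟨hi, hj, hij, hs, hl⟩ := hx
      refine ⟨?_, ?_, hij, hs, hl.mono (Finset.erase_subset _ _)⟩ <;>
      · simp only [mem_signedPoints, Finset.mem_erase] at hi hj ⊢
        first
        | exact hi.imp (fun m => ⟨by omega, m⟩) (fun m => ⟨by omega, m⟩)
        | exact hj.imp (fun m => ⟨by omega, m⟩) (fun m => ⟨by omega, m⟩)
  calc _ ≤ _ := Finset.card_le_card hsub
    _ ≤ _ := Finset.card_union_le _ _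
    _ ≤ _ := by gcongr; exact Finset.card_image_le

/-- The links between `q` and `±p` are left out of the second term because they already appear, up
to sign, among the neighbours of `p`. -/
theorem card_linkPairs_le_erase_erase (hodd : ∀ k, h (-k) = -h k) (hpos : ∀ a ∈ A, 0 < a)
    (hp : p ∈ A) (hq : q ∈ A) :
    (linkPairs h A).card ≤ (linkPairs h ((A.erase p).erase q)).card +
      ((linkNbrs h A p).card + (linkNbrs h A q \ {p, -p}).card) := by
  have hsub : linkPairs h A ⊆ linkPairs h ((A.erase p).erase q) ∪
      ((linkNbrs h A p).image (pairWith p) ∪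
        (linkNbrs h A q \ {p, -p}).image (pairWith q)) := by
    intro x hx
    rw [Finset.mem_union, Finset.mem_union]
    by_cases hxp : x.1 = p ∨ x.1 = -p ∨ x.2 = p ∨ x.2 = -p
    · right; left
      obtain ⟨r, hr, e, -⟩ := mem_pairWith_image hodd hpos hp hx hxp
      exact Finset.mem_image.2 ⟨r, hr, e⟩
    · by_cases hxq : x.1 = q ∨ x.1 = -q ∨ x.2 = q ∨ x.2 = -q
      · right; right
        obtain ⟨r, hr, e, h4, -⟩ := mem_pairWith_image hodd hpos hq hx hxq
        refine Finset.mem_image.2 ⟨r, ?_, e⟩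
        simp only [Finset.mem_sdiff, hr, Finset.mem_insert, Finset.mem_singleton, true_and]
        omega
      · left
        rw [mem_linkPairs] at hx ⊢
        obtain ⟨hi, hj, hij, hs, hl⟩ := hx
        refine ⟨?_, ?_, hij, hs, hl.mono ((Finset.erase_subset _ _).trans
          (Finset.erase_subset _ _))⟩ <;>
        · simp only [mem_signedPoints, Finset.mem_erase] at hi hj ⊢
          first
          | exact hi.imp (fun m => ⟨by omega, by omega, m⟩) (fun m => ⟨by omega, by omega, m⟩)
          | exact hj.imp (fun m => ⟨by omega, by omega, m⟩) (fun m => ⟨by omega, by omega, m⟩)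
  calc _ ≤ _ := Finset.card_le_card hsub
    _ ≤ _ := Finset.card_union_le _ _
    _ ≤ _ := by
      gcongr
      exact (Finset.card_union_le _ _).trans (add_le_add Finset.card_image_le
        Finset.card_image_le)

/-- A discrete intermediate value principle. Applied to a threshold on heights, it yields a jump
across that threshold; a bound on the gaps then confines one end of the jump to a prescribed window,
usually inside a box that should be empty. -/
theorem exists_consecutive_of_not {P : ℤ → Prop} {s t : ℤ} (hs : s ∈ A) (ht : t ∈ A)
    (hst : s < t) (hPs : P s) (hPt : ¬ P t) :
    ∃ k k', Consecutive A k k' ∧ s ≤ k ∧ k' ≤ t ∧ P k ∧ ¬ P k' := by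
  classical
  obtain ⟨k', hk', hmin⟩ := (A.filter (fun k => s ≤ k ∧ ¬ P k)).exists_minimal
    ⟨t, by simp [ht, hst.le, hPt]⟩
  simp only [Finset.mem_filter] at hk' hmin
  have hsk : s < k' := lt_of_le_of_ne hk'.2.1 (by rintro rfl; exact hk'.2.2 hPs)
  obtain ⟨k, hk, hmax⟩ := (A.filter (fun k => s ≤ k ∧ k < k')).exists_maximal
    ⟨s, by simp [hs, hsk]⟩
  simp only [Finset.mem_filter] at hk hmax
  have hPk : P k := by
    by_contra hP
    have := hmin ⟨hk.1, hk.2.1, hP⟩ hk.2.2.le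
    omega
  refine ⟨k, k', ⟨hk.1, hk'.1, hk.2.2, fun l hl hb => ?_⟩, hk.2.1, ?_, hPk, hk'.2.2⟩
  · have := hmax ⟨hl, by omega, hb.2⟩ hb.1.le
    omega
  · by_contra hc
    have := hmin ⟨ht, hst.le, hPt⟩ (by omega)
    omega

theorem exists_consecutive_max_gap (h : ℤ → ℤ) (hA : 2 ≤ A.card) :
    ∃ p q, Consecutive A p q ∧ ∀ s t, Consecutive A s t → |h s - h t| ≤ |h p - h q| := by
  classical
  obtain ⟨a, ha, b, hb, hab⟩ := Finset.one_lt_card.1 (by omega : 1 < A.card)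
  wlog hlt : a < b generalizing a b
  · exact this b hb a ha hab.symm (by omega)
  obtain ⟨k, k', hk, -⟩ := exists_consecutive_of_not (P := fun x => x < b) ha hb hlt hlt (by simp)
  obtain ⟨x, hx, hmax⟩ := ((A ×ˢ A).filter (fun x => Consecutive A x.1 x.2)).exists_max_image
    (fun x => |h x.1 - h x.2|) ⟨(k, k'), by simp [hk, hk.1, hk.2.1]⟩
  simp only [Finset.mem_filter, Finset.mem_product] at hx hmax
  exact ⟨x.1, x.2, hx.2, fun s t hst => hmax (s, t) ⟨⟨hst.1, hst.2.1⟩, hst⟩⟩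

end LinkBasics

/-! ### Common neighbours of two consecutive points. -/

section CommonNeighbours

variable {h : ℤ → ℤ} {A : Finset ℤ} {p q r r' k u : ℤ}

/-- The points linked to both `p` and `q`, other than `±p` and `±q`. -/
noncomputable def commonNbrs (h : ℤ → ℤ) (A : Finset ℤ) (p q : ℤ) : Finset ℤ :=
  (linkNbrs h A p ∩ linkNbrs h A q) \ {p, -p, q, -q}

theorem mem_commonNbrs : r ∈ commonNbrs h A p q ↔ r ∈ signedPoints A ∧ Linked h A p r ∧
    Linked h A q r ∧ r ≠ p ∧ r ≠ -p ∧ r ≠ q ∧ r ≠ -q := by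
  simp only [commonNbrs, Finset.mem_sdiff, Finset.mem_inter, mem_linkNbrs, Finset.mem_insert,
    Finset.mem_singleton, not_or]
  tauto

theorem commonNbrs_flip : commonNbrs (fun k => -h k) A p q = commonNbrs h A p q := by
  simp [commonNbrs, linkNbrs_flip]

/-- Of two such points, the one horizontally nearer to `p` and `q` lies in the box from `p` to the
farther one if it is the lower of the two, and in the box from `q` to the farther one if it is the
higher. -/
theorem common_right_unique (hr : Linked h A p r) (hr' : Linked h A p r')
    (hqr : Linked h A q r) (hqr' : Linked h A q r') (hrA : r ∈ signedPoints A)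
    (hrA' : r' ∈ signedPoints A) (hinj : Function.Injective h)
    (hside : (p < r ∧ q < r ∧ p < r' ∧ q < r') ∨ (r < p ∧ r < q ∧ r' < p ∧ r' < q))
    (h1 : h p < h r ∧ h r < h q) (h2 : h p < h r' ∧ h r' < h q) : r = r' := by
  rw [mem_signedPoints] at hrA hrA'
  have a1 := hr.2.2 r' hrA'
  have a2 := hr'.2.2 r hrA
  have a3 := hqr.2.2 r' hrA'
  have a4 := hqr'.2.2 r hrA
  unfold InBox at *
  by_contra hne
  have : h r ≠ h r' := fun e => hne (hinj e)
  omega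

variable (hodd : ∀ k, h (-k) = -h k) (hinj : Function.Injective h) (hpos : ∀ a ∈ A, 0 < a)

include hodd hinj hpos in
-- If the height of `r` is not between `h p` and `h q`, the heights must cross a window as long as
-- the maximal gap on the way from `r` to `p` or `q`, and a point that lands in the window obstructs
-- a box. The escape is the third alternative: `r` is negative and the crossing can hide in the jump
-- over the origin, between `-u` and `u`.
theorem common_cases (hc : Consecutive A p q)
    (hgap : ∀ s t, Consecutive A s t → |h s - h t| ≤ |h p - h q|) (hxy : h p < h q)
    (hu : u ∈ A) (hmin : ∀ k ∈ A, u ≤ k)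
    (hr : r ∈ commonNbrs h A p q) :
    (q < r ∧ h p < h r ∧ h r < h q) ∨ (r < p ∧ h p < h r ∧ h r < h q) ∨
      (r < 0 ∧ h q < h r ∧ h r ≤ -h u ∧ h u ≤ h p) := by
  rw [mem_commonNbrs, mem_signedPoints] at hr
  obtain ⟨hrA, hl, hl', n1, n2, n3, n4⟩ := hr
  obtain ⟨hp, hq, hpq, hbtw⟩ := hc
  have hp0 := hpos p hp
  have d1 : h r ≠ h p := fun e => n1 (hinj e)
  have d2 : h r ≠ h q := fun e => n3 (hinj e)
  have b1 := hl.2.2 q (Or.inl hq)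
  have b2 := hl'.2.2 p (Or.inl hp)
  have hrpos : 0 < r → r ∈ A := fun h0 => hrA.resolve_right fun hm => by
    have := hpos _ hm; omega
  have hgap' : ∀ s t, Consecutive A s t → |h s - h t| ≤ h q - h p := fun s t hst =>
    (hgap s t hst).trans (by rw [abs_sub_comm, abs_of_pos (by omega)])
  have side : r < p ∨ q < r := by
    by_contra hcon
    exact hbtw r (hrpos (by omega)) (by omega)
  have e1 := fun k (hk : k ∈ A) => hl.not_between hk
  have e2 := fun k (hk : k ∈ A) => hl'.not_between hk
  unfold InBox at *
  rcases side with side | side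
  · have hpr : h p < h r := by omega
    by_cases hrq : h r < h q
    · exact Or.inr (Or.inl ⟨side, hpr, hrq⟩)
    right; right
    have hrq' : h q < h r := by omega
    by_cases h0 : 0 < r
    · exfalso
      -- The heights descend from `h r > h q` to `h p`. The first point below `h r` loses at most `h
      -- q - h p`, so it is still above `h p` and lies in the box of `p` and `r`.
      obtain ⟨k, k', hk, hrk, hkp, hP, hP'⟩ := exists_consecutive_of_not
        (P := fun k => h r ≤ h k) (hrpos h0) hp side le_rfl (by simp; omega)
      have g := abs_le.1 (hgap' k k' hk)
      have := e1 k' hk.2.1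
      have := hk.2.2.1
      have : k' = p → h k' = h p := fun e => by rw [e]
      omega
    have hr0 : r < 0 := by
      rcases hrA with hm | hm <;> have := hpos _ hm <;> omega
    have hrA' : -r ∈ A := hrA.resolve_left fun hm => by have := hpos _ hm; omega
    have hnr := hodd r
    have key1 : h r ≤ -h u := by
      by_contra hcon
      have hur : u < -r := lt_of_le_of_ne (hmin _ hrA') (by
        rintro rfl; omega)
      have := hl.not_between_neg hodd hu
      have := hmin p hp
      have := hpos u hu
      -- The same argument on the negative side, for the points `-k` with `k` running from `u` to
      -- `-r`: the point `-k'` rises above `h p` but not above `h q < h r`.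
      obtain ⟨k, k', hk, hrk, hkp, hP, hP'⟩ := exists_consecutive_of_not
        (P := fun k => -h k ≤ h p) hu hrA' hur (by omega) (by simp; omega)
      have g := abs_le.1 (hgap' k k' hk)
      have t := hl.not_between_neg hodd hk.2.1
      have := hk.2.2.1
      have : k' = -r → h k' = -h r := fun e => by rw [e, hodd]
      omega
    refine ⟨hr0, hrq', key1, ?_⟩
    by_contra hcon
    have hup : u < p := lt_of_le_of_ne (hmin _ hp) (by
        rintro rfl; omega)
    -- Here the crossing occurs between `u` and `p`; the last point `k` above `h p` is at most `h
    -- q`, hence in the box of `p` and `r`.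
    obtain ⟨k, k', hk, hrk, hkp, hP, hP'⟩ := exists_consecutive_of_not
        (P := fun k => h p < h k) hu hp hup (by omega) (by simp)
    have g := abs_le.1 (hgap' k k' hk)
    have t := e1 k hk.1
    have := hk.2.2.1
    have := hpos u hu
    have : k = u → h k = h u := fun e => by rw [e]
    omega
  · left
    refine ⟨side, ?_⟩
    by_contra hcon
    have hrp : h r < h p := by omega
    -- To the right of `q` the emptiness of the box of `p` and `r` already gives `h r < h q`. A
    -- descent below `h p` would leave a point `k'` in the box of `q` and `r`.
    obtain ⟨k, k', hk, hrk, hkp, hP, hP'⟩ := exists_consecutive_of_not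
        (P := fun k => h q ≤ h k) hq (hrpos (by omega)) side le_rfl (by simp; omega)
    have g := abs_le.1 (hgap' k k' hk)
    have t := e2 k' hk.2.1
    have := hk.2.2.1
    have : k' = r → h k' = h r := fun e => by rw [e]
    omega

open Classical in
/-- `1` if `p` and `r` are linked and `0` otherwise. -/
noncomputable def linkInd (h : ℤ → ℤ) (A : Finset ℤ) (p r : ℤ) : ℕ := if Linked h A p r then 1 else 0

theorem linkInd_le_one : linkInd h A p r ≤ 1 := by unfold linkInd; split_ifs <;> simp

theorem linkInd_eq_zero (hl : ¬ Linked h A p r) : linkInd h A p r = 0 := by simp [linkInd, hl]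

theorem linked_of_linkInd (hl : linkInd h A p r ≠ 0) : Linked h A p r := by
  by_contra hc; exact hl (linkInd_eq_zero hc)

/-- Inclusion–exclusion away from `±p, ±q`. Among these four points themselves only four links can
count: `p` with `-p`, `q` with `-q`, `p` with `q`, and `p` with `-q`. -/
theorem card_linkNbrs_pair_le :
    (linkNbrs h A p).card + (linkNbrs h A q \ {p, -p}).card ≤
      ((linkNbrs h A p ∪ linkNbrs h A q) \ {p, -p, q, -q}).card + (commonNbrs h A p q).card +
        (linkInd h A p (-p) + linkInd h A q (-q) + linkInd h A p q + linkInd h A p (-q)) := by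
  classical
  set Z : Finset ℤ := {p, -p, q, -q}
  have e0 := Finset.card_union_add_card_inter (linkNbrs h A p \ Z) (linkNbrs h A q \ Z)
  have e1 : linkNbrs h A p \ Z ∪ linkNbrs h A q \ Z = (linkNbrs h A p ∪ linkNbrs h A q) \ Z := by
    ext; simp only [Finset.mem_union, Finset.mem_sdiff]; tauto
  have e2 : linkNbrs h A p \ Z ∩ (linkNbrs h A q \ Z) = commonNbrs h A p q := by
    ext; simp only [commonNbrs, Finset.mem_inter, Finset.mem_sdiff, Z]; tauto
  rw [e1, e2] at e0
  have single : ∀ a b : ℤ, (({b} : Finset ℤ).filter (Linked h A a)).card = linkInd h A a b := by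
    intro a b
    rw [Finset.filter_singleton, linkInd]
    split_ifs <;> simp
  have f1 : linkNbrs h A p ⊆ (linkNbrs h A p \ Z) ∪ (({-p} : Finset ℤ).filter (Linked h A p) ∪
      (({q} : Finset ℤ).filter (Linked h A p) ∪ ({-q} : Finset ℤ).filter (Linked h A p))) := by
    intro r hr
    have hl := (mem_linkNbrs.1 hr).2
    have : r ≠ p := hl.1.symm
    simp only [Finset.mem_union, Finset.mem_sdiff, Finset.mem_filter, Finset.mem_singleton, Z,
      Finset.mem_insert]
    tauto
  have f2 : linkNbrs h A q \ {p, -p} ⊆ (linkNbrs h A q \ Z) ∪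
      ({-q} : Finset ℤ).filter (Linked h A q) := by
    intro r hr
    rw [Finset.mem_sdiff] at hr
    have hl := (mem_linkNbrs.1 hr.1).2
    have : r ≠ q := hl.1.symm
    simp only [Finset.mem_union, Finset.mem_sdiff, Finset.mem_filter, Finset.mem_singleton, Z,
      Finset.mem_insert] at *
    tauto
  have g1 := (Finset.card_le_card f1).trans (Finset.card_union_le _ _)
  have g2 := Finset.card_union_le (({-p} : Finset ℤ).filter (Linked h A p))
      (({q} : Finset ℤ).filter (Linked h A p) ∪ ({-q} : Finset ℤ).filter (Linked h A p))
  have g3 := Finset.card_union_le (({q} : Finset ℤ).filter (Linked h A p))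
      (({-q} : Finset ℤ).filter (Linked h A p))
  have g4 := (Finset.card_le_card f2).trans (Finset.card_union_le _ _)
  rw [single] at g4
  rw [single] at g2
  rw [single, single] at g3
  omega

/-- The number of points of `±A` other than `±p` and `±q`. -/
theorem card_signedPoints_sdiff (hpos : ∀ a ∈ A, 0 < a) (hp : p ∈ A) (hq : q ∈ A) (hpq : p ≠ q) :
    (signedPoints A \ {p, -p, q, -q}).card + 4 = 2 * A.card := by
  have hp0 := hpos p hp
  have hq0 := hpos q hq
  rw [← card_signedPoints hpos, ← Finset.card_sdiff_add_card_eq_card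
    (s := {p, -p, q, -q}) (t := signedPoints A)]
  · congr 1
    rw [Finset.card_insert_of_notMem, Finset.card_insert_of_notMem, Finset.card_insert_of_notMem,
      Finset.card_singleton] <;> simp <;> omega
  · intro k hk
    simp only [Finset.mem_insert, Finset.mem_singleton] at hk
    rw [mem_signedPoints]
    rcases hk with rfl | rfl | rfl | rfl <;> simp [hp, hq]

theorem union_nbrs_sdiff_subset :
    (linkNbrs h A p ∪ linkNbrs h A q) \ {p, -p, q, -q} ⊆ signedPoints A \ {p, -p, q, -q} := by
  refine Finset.sdiff_subset_sdiff (Finset.union_subset ?_ ?_) (Finset.Subset.refl _) <;>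
  · intro r hr; exact (mem_linkNbrs.1 hr).1

end CommonNeighbours

/-! ### The neighbours of the two points at the largest gap. -/

section PairBound

variable {h : ℤ → ℤ} {A : Finset ℤ} {p q r r' k u : ℤ}
variable (hodd : ∀ k, h (-k) = -h k) (hinj : Function.Injective h) (hpos : ∀ a ∈ A, 0 < a)

include hinj in
theorem card_common_right_le (hpq : p < q)
    (hC : ∀ r ∈ commonNbrs h A p q, (q < r ∧ h p < h r ∧ h r < h q) ∨
      (r < p ∧ h p < h r ∧ h r < h q)) :
    ((commonNbrs h A p q).filter (q < ·)).card ≤ 1 := by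
  refine Finset.card_le_one.2 fun r hr s hs => ?_
  rw [Finset.mem_filter] at hr hs
  have a := hC r hr.1
  have b := hC s hs.1
  have c := mem_commonNbrs.1 hr.1
  have d := mem_commonNbrs.1 hs.1
  exact common_right_unique c.2.1 d.2.1 c.2.2.1 d.2.2.1 c.1 d.1 hinj (by omega) (by omega)
    (by omega)

include hinj in
theorem card_common_left_le (hpq : p < q)
    (hC : ∀ r ∈ commonNbrs h A p q, (q < r ∧ h p < h r ∧ h r < h q) ∨
      (r < p ∧ h p < h r ∧ h r < h q)) :
    ((commonNbrs h A p q).filter (· < p)).card ≤ 1 := by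
  refine Finset.card_le_one.2 fun r hr s hs => ?_
  rw [Finset.mem_filter] at hr hs
  have a := hC r hr.1
  have b := hC s hs.1
  have c := mem_commonNbrs.1 hr.1
  have d := mem_commonNbrs.1 hs.1
  exact common_right_unique c.2.1 d.2.1 c.2.2.1 d.2.2.1 c.1 d.1 hinj (by omega) (by omega)
    (by omega)

theorem card_common_le
    (hC : ∀ r ∈ commonNbrs h A p q, (q < r ∧ h p < h r ∧ h r < h q) ∨
      (r < p ∧ h p < h r ∧ h r < h q)) :
    (commonNbrs h A p q).card ≤ ((commonNbrs h A p q).filter (q < ·)).card +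
      ((commonNbrs h A p q).filter (· < p)).card := by
  refine (Finset.card_le_card ?_).trans (Finset.card_union_le _ _)
  intro r hr
  have := hC r hr
  simp only [Finset.mem_union, Finset.mem_filter, hr, true_and]
  omega

include hodd hinj hpos in
-- The budget is `(2 n - 4) + 2 + 2` with `n = A.card`: at most two common neighbours, at most one
-- of the two loops, and possibly the link of `p` and `q`. The points over `p` and `-q` are in
-- opposite quadrants, so they are not linked.
theorem card_nbrs_pair_le_of_same_sign (hp : p ∈ A) (hq : q ∈ A) (hpq : p < q)
    (hC : ∀ r ∈ commonNbrs h A p q, (q < r ∧ h p < h r ∧ h r < h q) ∨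
      (r < p ∧ h p < h r ∧ h r < h q))
    (hxy : h p < h q) (hs : 0 < h p ∨ h q < 0)
    (hloop : ¬ (Linked h A p (-p) ∧ Linked h A q (-q))) :
    (linkNbrs h A p).card + (linkNbrs h A q \ {p, -p}).card ≤ 2 * A.card := by
  have h1 := card_linkNbrs_pair_le (h := h) (A := A) (p := p) (q := q)
  have h2 := card_signedPoints_sdiff hpos hp hq hpq.ne
  have h3 := Finset.card_le_card (union_nbrs_sdiff_subset (h := h) (A := A) (p := p) (q := q))
  have h4 := card_common_right_le hinj hpq hC
  have h5 := card_common_left_le hinj hpq hC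
  have h6 := card_common_le hC
  have h7 : linkInd h A p (-p) + linkInd h A q (-q) ≤ 1 := by
    have := linkInd_le_one (h := h) (A := A) (p := p) (r := -p)
    have := linkInd_le_one (h := h) (A := A) (p := q) (r := -q)
    by_cases hl : Linked h A p (-p)
    · rw [linkInd_eq_zero (p := q) fun h' => hloop ⟨hl, h'⟩]; omega
    · rw [linkInd_eq_zero hl]; omega
  have h8 : linkInd h A p (-q) = 0 := linkInd_eq_zero fun hl => by
    have := hpos p hp
    have := hodd q
    have := hl.2.1
    unfold Central at this
    omega
  have := linkInd_le_one (h := h) (A := A) (p := p) (r := q)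
  omega

include hodd hinj hpos in
-- A common neighbour on the left excludes two of the four special links, which leaves at most `(2 n
-- - 4) + 2 + 2`. Without one the bound is `(2 n - 4) + 1 + 4 = 2 n + 1`, so exceeding `2 n` forces
-- equality everywhere, and that is the conclusion.
theorem card_nbrs_pair_le_of_opposite_sign (hp : p ∈ A) (hq : q ∈ A) (hpq : p < q)
    (hC : ∀ r ∈ commonNbrs h A p q, (q < r ∧ h p < h r ∧ h r < h q) ∨
      (r < p ∧ h p < h r ∧ h r < h q))
    (hx : h p < 0) (hy : 0 < h q)
    (hT : 2 * A.card < (linkNbrs h A p).card + (linkNbrs h A q \ {p, -p}).card) :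
    Linked h A p (-p) ∧ Linked h A q (-q) ∧ Linked h A p q ∧ Linked h A p (-q) ∧
      (∀ r ∈ signedPoints A, r ≠ p → r ≠ -p → r ≠ q → r ≠ -q → Linked h A p r ∨ Linked h A q r) ∧
      ∃ R ∈ commonNbrs h A p q, q < R ∧ (∀ r ∈ commonNbrs h A p q, r = R) := by
  have h1 := card_linkNbrs_pair_le (h := h) (A := A) (p := p) (q := q)
  have h2 := card_signedPoints_sdiff hpos hp hq hpq.ne
  have hsub := union_nbrs_sdiff_subset (h := h) (A := A) (p := p) (q := q)
  have h3 := Finset.card_le_card hsub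
  have h4 := card_common_right_le hinj hpq hC
  have h5 := card_common_left_le hinj hpq hC
  have h6 := card_common_le hC
  have i1 := linkInd_le_one (h := h) (A := A) (p := p) (r := -p)
  have i2 := linkInd_le_one (h := h) (A := A) (p := q) (r := -q)
  have i3 := linkInd_le_one (h := h) (A := A) (p := p) (r := q)
  have i4 := linkInd_le_one (h := h) (A := A) (p := p) (r := -q)
  have hp0 := hpos p hp
  have oq := hodd q
  have op := hodd p
  by_cases hL : ∃ r ∈ commonNbrs h A p q, r < p
  · exfalso
    obtain ⟨L, hL, hLp⟩ := hL
    have hLb : h p < h L ∧ h L < h q := by have := hC L hL; omega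
    obtain ⟨hLA, l1, l2, n1, n2, n3, n4⟩ := mem_commonNbrs.1 hL
    rw [mem_signedPoints] at hLA
    have hL0 : h L ≠ 0 := fun e => by
      have h0 : h 0 = 0 := by have := hodd 0; simp at this; omega
      have : L = 0 := hinj (e.trans h0.symm)
      subst this
      rcases hLA with hm | hm <;> simpa using hpos _ hm
    -- A negative `L` would need a height of the same sign as both `h p < 0` and `h q > 0`.
    have hLpos : 0 < L := by
      have c1 := l1.2.1
      have c2 := l2.2.1
      unfold Central at c1 c2
      have : L ≠ 0 := by rintro rfl; rcases hLA with hm | hm <;> simpa using hpos _ hm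
      omega
    have hLA' : L ∈ A := hLA.resolve_right fun hm => by have := hpos _ hm; omega
    have n5 : h L ≠ -h p := fun e => n2 (hinj (by rw [hodd, e]))
    have n6 : h L ≠ -h q := fun e => n4 (hinj (by rw [hodd, e]))
    have pl : Linked h A p (-p) → -h p < h L := fun hl => by
      have := hl.not_between hLA'
      omega
    -- If `p` and `-q` are linked, neither loop exists: a loop at `p` would put `-L` in the box of
    -- `p` and `-q`, and a loop at `q` would imply one at `p`. If they are not linked, the two loops
    -- cannot coexist because of `L`.
    by_cases hm : Linked h A p (-q)
    · have z1 : ¬ Linked h A p (-p) := fun hl => by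
        have := pl hl
        have := hm.not_between_neg hodd hLA'
        omega
      have z2 : ¬ Linked h A q (-q) := fun hl => by
        refine z1 ⟨by omega, Or.inl rfl, fun k hk hb => ?_⟩
        have a1 := hl.2.2 k hk
        have a2 := hm.2.2 k hk
        have a3 := hm.2.2 (-k) (by rw [neg_neg]; tauto)
        have ok := hodd k
        have c1 : h k ≠ h q := fun e => by
          have := hinj e
          unfold InBox at hb
          omega
        have c2 : h k ≠ -h q := fun e => by
          have := hinj (e.trans oq.symm)
          unfold InBox at hb
          omega
        unfold InBox at *
        omega
      rw [linkInd_eq_zero z1, linkInd_eq_zero z2] at h1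
      omega
    · have z : ¬ (Linked h A p (-p) ∧ Linked h A q (-q)) := fun hl => by
        have := pl hl.1
        have := hl.2.not_between hLA'
        omega
      rw [linkInd_eq_zero hm] at h1
      have h7 : linkInd h A p (-p) + linkInd h A q (-q) ≤ 1 := by
        by_cases hl : Linked h A p (-p)
        · rw [linkInd_eq_zero (p := q) fun h' => z ⟨hl, h'⟩]; omega
        · rw [linkInd_eq_zero hl]; omega
      omega
  · push Not at hL
    have h7 : ((commonNbrs h A p q).filter (· < p)).card = 0 := by
      rw [Finset.card_eq_zero, Finset.filter_eq_empty_iff]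
      intro r hr
      have := hL r hr
      omega
    have hcard : (commonNbrs h A p q).card = 1 := by omega
    refine ⟨linked_of_linkInd (by omega), linked_of_linkInd (by omega),
      linked_of_linkInd (by omega), linked_of_linkInd (by omega), ?_, ?_⟩
    · intro r hr e1 e2 e3 e4
      have heq := Finset.eq_of_subset_of_card_le hsub (by omega)
      have : r ∈ signedPoints A \ {p, -p, q, -q} := by simp [hr, e1, e2, e3, e4]
      rw [← heq] at this
      simp only [Finset.mem_sdiff, Finset.mem_union, mem_linkNbrs] at this
      tauto
    · obtain ⟨R, hR⟩ := Finset.card_eq_one.1 hcard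
      refine ⟨R, by simp [hR], ?_, by simp [hR]⟩
      have hm : R ∈ commonNbrs h A p q := by simp [hR]
      have := hL R hm
      have := hC R hm
      omega

/-- The configuration of two consecutive points which is exceptional for the bound on the number
of their neighbours. -/
structure Exceptional (h : ℤ → ℤ) (A : Finset ℤ) (p q R : ℤ) : Prop where
  loop_left : Linked h A p (-p)
  loop_right : Linked h A q (-q)
  linked : Linked h A p q
  linked_neg : Linked h A p (-q)
  cover : ∀ r ∈ signedPoints A, r ≠ p → r ≠ -p → r ≠ q → r ≠ -q →
    Linked h A p r ∨ Linked h A q r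
  mem_common : R ∈ commonNbrs h A p q
  lt : q < R
  unique : ∀ r ∈ commonNbrs h A p q, r = R
  signs : (h p < 0 ∧ 0 < h q) ∨ (h q < 0 ∧ 0 < h p)

theorem Exceptional.flip {R : ℤ} (he : Exceptional h A p q R) :
    Exceptional (fun k => -h k) A p q R := by
  obtain ⟨h1, h2, h3, h4, h5, h6, h7, h8, h9⟩ := he
  refine ⟨h1.flip, h2.flip, h3.flip, h4.flip, ?_, ?_, h7, ?_, ?_⟩
  · simpa only [linked_flip] using h5
  · rwa [commonNbrs_flip]
  · rwa [commonNbrs_flip]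
  · omega

/-- A symmetric empty box forces every earlier position to have a larger absolute height. With
several loops, absolute heights therefore decrease. -/
theorem Linked.loop_not_between (hl : Linked h A p (-p)) (hk : k ∈ A) (hkp : k < p) (hk0 : 0 < k)
    (hodd : ∀ k, h (-k) = -h k) (hinj : Function.Injective h) : |h p| < |h k| := by
  have a := hl.not_between hk
  have : h k ≠ h p := fun e => by have := hinj e; omega
  have : h k ≠ -h p := fun e => by
    have := hinj (e.trans (hodd p).symm)
    omega
  have := hodd p
  rcases abs_cases (h p) with ⟨e, _⟩ | ⟨e, _⟩ <;> rcases abs_cases (h k) with ⟨e', _⟩ | ⟨e', _⟩ <;>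
    rw [e, e'] <;> omega

theorem ne_zero_of_odd (hodd : ∀ k, h (-k) = -h k) (hinj : Function.Injective h) (hk : k ≠ 0) :
    h k ≠ 0 := fun e => by
  have h0 : h 0 = 0 := by have := hodd 0; simp at this; omega
  exact hk (hinj (e.trans h0.symm))

/-- The neighbours of two consecutive points at maximal distance. -/
theorem card_nbrs_pair_le (hodd : ∀ k, h (-k) = -h k) (hinj : Function.Injective h)
    (hpos : ∀ a ∈ A, 0 < a) (hc : Consecutive A p q)
    (hgap : ∀ s t, Consecutive A s t → |h s - h t| ≤ |h p - h q|)
    (hu : u ∈ A) (hmin : ∀ k ∈ A, u ≤ k) (hD : |h u| < |h p - h q|)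
    (hT : 2 * A.card < (linkNbrs h A p).card + (linkNbrs h A q \ {p, -p}).card) :
    ∃ R, Exceptional h A p q R := by
  wlog hxy : h p < h q generalizing h
  · have hne : h p ≠ h q := fun e => hc.2.2.1.ne (hinj e)
    have habs : ∀ s t, |(fun k => -h k) s - (fun k => -h k) t| = |h s - h t| := fun s t => by
      rw [← abs_neg]; congr 1; ring
    obtain ⟨R, hR⟩ := this (h := fun k => -h k) (fun k => by simp [hodd])
      (fun a b e => hinj (neg_injective e)) (fun s t hst => by rw [habs, habs]; exact hgap s t hst)
      (by rw [habs, abs_neg]; exact hD) (by rwa [linkNbrs_flip, linkNbrs_flip])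
      (by omega)
    refine ⟨R, ?_⟩
    simpa using hR.flip
  have hp := hc.1
  have hq := hc.2.1
  have hpq := hc.2.2.1
  have hp0 := hpos p hp
  have hu0 := hpos u hu
  have x0 := ne_zero_of_odd hodd hinj hp0.ne'
  have y0 := ne_zero_of_odd hodd hinj (hpos q hq).ne'
  have hD' : |h u| < h q - h p := by rwa [abs_sub_comm, abs_of_pos (a := h q - h p) (by omega)] at hD
  have hC : ∀ r ∈ commonNbrs h A p q, (q < r ∧ h p < h r ∧ h r < h q) ∨
      (r < p ∧ h p < h r ∧ h r < h q) := fun r hr => by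
    rcases common_cases hodd hinj hpos hc hgap hxy hu hmin hr with h1 | h1 | ⟨h1, h2, h3, h4⟩
    · exact Or.inl h1
    · exact Or.inr h1
    -- In the third case `h p`, `h q` and `h r` have the same sign, because `r` is negative and not
    -- central to `p` or `q`. This confines `h p` and `h q` to an interval shorter than `|h u|`.
    · exfalso
      obtain ⟨-, l1, l2, n1, n2, n3, n4⟩ := mem_commonNbrs.1 hr
      have c1 := l1.2.1
      have c2 := l2.2.1
      have := ne_zero_of_odd hodd hinj h1.ne
      have := neg_abs_le (h u)
      have := neg_le_abs (h u)
      unfold Central at c1 c2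
      omega
  by_cases hs : 0 < h p ∨ h q < 0
  · exfalso
    refine absurd hT (not_lt.2 (card_nbrs_pair_le_of_same_sign hodd hinj hpos hp hq hpq hC hxy hs ?_))
    -- Two loops would give `|h q| < |h p| ≤ |h u|`, and for equal signs the gap would be smaller
    -- than `|h u|`.
    rintro ⟨l1, l2⟩
    have a1 := l2.loop_not_between hp hpq hp0 hodd hinj
    rcases (hmin p hp).eq_or_lt with e | hlt
    · subst e
      rcases abs_cases (h u) with ⟨e, _⟩ | ⟨e, _⟩ <;> rw [e] at hD' <;>
        rcases abs_cases (h q) with ⟨e', _⟩ | ⟨e', _⟩ <;> omega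
    · have a2 := l1.loop_not_between hu hlt hu0 hodd hinj
      rcases abs_cases (h p) with ⟨e, _⟩ | ⟨e, _⟩ <;>
        rcases abs_cases (h q) with ⟨e', _⟩ | ⟨e', _⟩ <;> omega
  · obtain ⟨h1, h2, h3, h4, h5, R, h6, h7, h8⟩ := card_nbrs_pair_le_of_opposite_sign hodd hinj hpos hp hq hpq
      hC (by omega) (by omega) hT
    exact ⟨R, h1, h2, h3, h4, h5, h6, h7, h8, by omega⟩

/-- If the gap at `p, q` is at least `2 * |h u|`, then `p, q` is not exceptional. -/
theorem Exceptional.gap_lt {R : ℤ} (he : Exceptional h A p q R) (hodd : ∀ k, h (-k) = -h k)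
    (hinj : Function.Injective h) (hpos : ∀ a ∈ A, 0 < a) (hp : p ∈ A) (hpq : p < q)
    (hu : u ∈ A) (hmin : ∀ k ∈ A, u ≤ k) : |h p - h q| < 2 * |h u| := by
  have a1 := he.loop_right.loop_not_between hp hpq (hpos p hp) hodd hinj
  have a2 : |h p| ≤ |h u| := by
    rcases (hmin p hp).eq_or_lt with e | hlt
    · rw [e]
    · exact (he.loop_left.loop_not_between hu hlt (hpos u hu) hodd hinj).le
  have := abs_sub (h p) (h q)
  omega

end PairBound

/-! ### All gaps small: the neighbours of the leftmost point. -/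

section SmallGaps

variable {h : ℤ → ℤ} {A : Finset ℤ} {p q r r' j k u R : ℤ}
variable (hodd : ∀ k, h (-k) = -h k) (hinj : Function.Injective h) (hpos : ∀ a ∈ A, 0 < a)
variable (hu : u ∈ A) (hmin : ∀ k ∈ A, u ≤ k) (hu0 : 0 < h u)
variable (hgap : ∀ s t, Consecutive A s t → |h s - h t| < 2 * h u)

include hodd hinj hpos hu hmin hu0 hgap in
-- The link with `-j` must not be central, which makes `h j` negative. Together the boxes from `u`
-- and from `-u` to `j` keep the intermediate heights either above `h u` or below both `-h u` and `h
-- j`. Passing from the first range to below `-h u` would take a jump of more than `2 * h u`, so the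
-- heights stay above `h u` until `j`.
theorem double_nbr_of_gap_lt (hj : j ∈ A) (h1 : Linked h A u j) (h2 : Linked h A u (-j)) :
    u < j ∧ h j < 0 ∧ -h u < h j ∧ (∀ k ∈ A, u < k → k < j → h u < h k) := by
  have huj : u < j := lt_of_le_of_ne (hmin j hj) h1.1
  have up := hpos u hu
  have hj0 := ne_zero_of_odd hodd hinj (hpos j hj).ne'
  have n1 : h j ≠ h u := fun e => huj.ne' (hinj e)
  have oj := hodd j
  have ou := hodd u
  have n2 : h j ≠ -h u := fun e => by
    have := hinj (e.trans ou.symm)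
    omega
  have hneg : h j < 0 := by
    have c2 := h2.2.1
    unfold Central at c2
    omega
  have h3 := h2.neg hodd
  rw [neg_neg] at h3
  have jump : ∀ k ∈ A, u < k → k ≤ j → (∀ l ∈ A, u < l → l ≤ k → h u < h l ∨ h l < -h u) →
      h u < h k := by
    intro k hk huk hkj hl
    by_contra hcon
    have : h k ≠ h u := fun e => huk.ne' (hinj e)
    obtain ⟨s, t, hst, hs, ht, hP, hP'⟩ := exists_consecutive_of_not
      (P := fun k => h u ≤ h k) hu hk huk le_rfl (by simp; omega)
    have g := abs_lt.1 (hgap s t hst)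
    have hst' := hst.2.2.1
    have := hl t hst.2.1 (by omega) ht
    omega
  have btw : ∀ k ∈ A, u < k → k < j → h u < h k ∨ (h k < -h u ∧ h k < h j) := by
    intro k hk huk hkj
    have a1 := h1.not_between hk
    have a2 := h3.not_between hk
    have m1 : h k ≠ h u := fun e => huk.ne' (hinj e)
    have m2 : h k ≠ -h u := fun e => by
      have := hinj (e.trans ou.symm)
      omega
    have m3 : h k ≠ h j := fun e => hkj.ne (hinj e)
    omega
  have hja : -h u < h j := by
    by_contra hcon
    have := jump j hj huj le_rfl fun l hl hul hlj => by
      rcases hlj.eq_or_lt with e | hlt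
      · subst e; omega
      · have := btw l hl hul hlt; omega
    omega
  refine ⟨huj, hneg, hja, fun k hk huk hkj => jump k hk huk hkj.le fun l hl hul hlk => ?_⟩
  have := btw l hl hul (by omega)
  omega

include hodd hinj hpos hu hmin hu0 hgap in
-- Two positions `a < b` cannot both be linked to `u` with both signs: `h a` is negative, while
-- everything between `u` and `b` is higher than `h u`. Each element of `A` thus counts once, with
-- at most one exception.
theorem card_linkNbrs_min_le : (linkNbrs h A u).card ≤ A.card + 1 ∧
    (A.card + 1 ≤ (linkNbrs h A u).card →
      (∀ j ∈ A, Linked h A u j ∨ Linked h A u (-j)) ∧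
        ∃ c ∈ A, Linked h A u c ∧ Linked h A u (-c)) := by
  classical
  have hdouble := fun j => double_nbr_of_gap_lt (j := j) hodd hinj hpos hu hmin hu0 hgap
  set P := A.filter (fun j => Linked h A u j)
  set N := A.filter (fun j => Linked h A u (-j))
  have hsub : linkNbrs h A u ⊆ P ∪ N.image (fun a => -a) := by
    intro r hr
    rw [mem_linkNbrs, mem_signedPoints] at hr
    rw [Finset.mem_union, Finset.mem_image]
    rcases hr with ⟨hr | hr, hl⟩
    · exact Or.inl (Finset.mem_filter.2 ⟨hr, hl⟩)
    · exact Or.inr ⟨-r, Finset.mem_filter.2 ⟨hr, by rwa [neg_neg]⟩, neg_neg r⟩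
  have h1 : (linkNbrs h A u).card ≤ P.card + N.card :=
    (Finset.card_le_card hsub).trans ((Finset.card_union_le _ _).trans
      (Nat.add_le_add_left Finset.card_image_le _))
  have h2 := Finset.card_union_add_card_inter P N
  have hPN : P ∪ N ⊆ A := Finset.union_subset (Finset.filter_subset _ _) (Finset.filter_subset _ _)
  have h3 := Finset.card_le_card hPN
  have h4 : (P ∩ N).card ≤ 1 := by
    refine Finset.card_le_one.2 fun a ha b hb => ?_
    simp only [P, N, Finset.mem_inter, Finset.mem_filter] at ha hb
    have da := hdouble a ha.1.1 ha.1.2 ha.2.2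
    have db := hdouble b hb.1.1 hb.1.2 hb.2.2
    rcases lt_trichotomy a b with hlt | e | hlt
    · have := db.2.2.2 a ha.1.1 da.1 hlt
      omega
    · exact e
    · have := da.2.2.2 b hb.1.1 db.1 hlt
      omega
  refine ⟨by omega, fun hcard => ⟨fun j hj => ?_, ?_⟩⟩
  · rw [← Finset.eq_of_subset_of_card_le hPN (by omega)] at hj
    simp only [P, N, Finset.mem_union, Finset.mem_filter] at hj
    tauto
  · obtain ⟨c, hc⟩ := Finset.card_pos.1 (by omega : 0 < (P ∩ N).card)
    simp only [P, N, Finset.mem_inter, Finset.mem_filter] at hc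
    exact ⟨c, hc.1.1, hc.1.2, hc.2.2⟩

include hodd hinj hpos hu hmin hu0 hgap in
-- All positions between `u` and `c` are higher than `h u`, so the jump that ends at `c` has size at
-- least `h u - h c`.
theorem exists_gap_of_double {c : ℤ} (hc : c ∈ A) (h1 : Linked h A u c)
    (h2 : Linked h A u (-c)) : ∃ s t, Consecutive A s t ∧ h u - h c ≤ |h s - h t| := by
  obtain ⟨huc, hneg, -, hbtw⟩ := double_nbr_of_gap_lt hodd hinj hpos hu hmin hu0 hgap hc h1 h2
  obtain ⟨s, t, hst, hs, ht, hP, hP'⟩ := exists_consecutive_of_not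
      (P := fun k => h u ≤ h k) hu hc huc le_rfl (by simp; omega)
  refine ⟨s, t, hst, ?_⟩
  have := hst.2.2.1
  have : t = c := by
    by_contra hne
    have := hbtw t hst.2.1 (by omega) (by omega)
    omega
  subst this
  have := le_abs_self (h s - h t)
  omega

include hodd hinj hpos hu hmin hu0 hgap in
-- If `p ≠ u`, the loops at `p` and `q` give `|h q| < |h p| ≤ |h c|`. Hence the gap is less than `2
-- |h c| < h u - h c`, against the hypothesis.
theorem Exceptional.eq_min {c : ℤ} (he : Exceptional h A p q R) (hp : p ∈ A) (hpq : p < q)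
    (hc : c ∈ A) (h1 : Linked h A u c) (h2 : Linked h A u (-c))
    (hD : h u - h c ≤ |h p - h q|) : p = u := by
  by_contra hne
  have hup : u < p := lt_of_le_of_ne (hmin p hp) (Ne.symm hne)
  obtain ⟨huc, hneg, hca, hbtw⟩ := double_nbr_of_gap_lt hodd hinj hpos hu hmin hu0 hgap hc h1 h2
  have a1 := he.loop_right.loop_not_between hp hpq (hpos p hp) hodd hinj
  have a2 := he.loop_left.loop_not_between hu hup (hpos u hu) hodd hinj
  rw [abs_of_pos hu0] at a2
  have hcp : c ≤ p := by
    by_contra hcon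
    have := hbtw p hp hup (by omega)
    have := le_abs_self (h p)
    omega
  have a3 : |h p| ≤ |h c| := by
    rcases hcp.eq_or_lt with e | hlt
    · rw [e]
    · exact (he.loop_left.loop_not_between hc hlt (hpos c hc) hodd hinj).le
  rw [abs_of_neg hneg] at a3
  have := abs_sub (h p) (h q)
  omega

include hodd hinj hpos hu hmin hu0 in
/-- In an exceptional configuration at the minimum, some point has few neighbours. -/
theorem Exceptional.exists_card_linkNbrs_le (he : Exceptional h A u q R) (hc : Consecutive A u q)
    (hall : ∀ j ∈ A, Linked h A u j ∨ Linked h A u (-j)) (hcard : 4 ≤ A.card) :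
    ∃ s ∈ A, (linkNbrs h A s).card ≤ A.card := by
  classical
  have hq := hc.2.1
  have huq := hc.2.2.1
  have up := hpos u hu
  have hq0 : h q < 0 := by have := he.signs; omega
  have a1 := he.loop_right.loop_not_between hu huq up hodd hinj
  rw [abs_of_pos hu0, abs_of_neg hq0] at a1
  have hgt : ∀ e ∈ A, e ≠ u → e ≠ q → q < e := fun e hm n1 n2 => by
    have := hc.2.2.2 e hm
    have := hmin e hm
    omega
  have hne0 : ∀ e ∈ A, h e ≠ 0 := fun e hm => ne_zero_of_odd hodd hinj (hpos e hm).ne'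
  have nq : ∀ e, q < e → h e ≠ h q ∧ h e ≠ h u := fun e hqe =>
    ⟨fun e' => hqe.ne' (hinj e'), fun e' => (huq.trans hqe).ne' (hinj e')⟩
  have cov : ∀ e ∈ A, e ≠ u → e ≠ q → (Linked h A u e ∨ Linked h A q e) ∧
      (Linked h A u (-e) ∨ Linked h A q (-e)) := fun e hm n1 n2 => by
    have e0 := hpos e hm
    exact ⟨he.cover e (mem_signedPoints.2 (Or.inl hm)) n1 (by omega) n2 (by omega),
      he.cover (-e) (mem_signedPoints.2 (Or.inr (by simpa using hm))) (by omega) (by omega)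
        (by omega) (by omega)⟩
  -- For a negative height, `q` and `-e` are central, so `u` is linked to `-e`; since `-q` must not
  -- obstruct that box, `e` is lower than `q`. Then `q` obstructs the box of `u` and `e`, which
  -- leaves the link of `q` and `e`.
  have low : ∀ e ∈ A, e ≠ q → h e < 0 → h e < h q ∧ Linked h A q e := fun e hm n2 e0 => by
    have n1 : e ≠ u := by rintro rfl; omega
    have hqe := hgt e hm n1 n2
    have hoe := hodd e
    obtain ⟨c1, c2⟩ := cov e hm n1 n2
    have l1 : Linked h A u (-e) := c2.resolve_right fun hl => by
      have := hl.2.1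
      unfold Central at this
      omega
    have b1 := l1.not_between_neg hodd hq
    have := nq e hqe
    have hlt : h e < h q := by omega
    refine ⟨hlt, c1.resolve_left fun hl => ?_⟩
    have := hl.not_between hq
    omega
  -- For a positive height, `u` and `-e` are central, so `u` is linked to `e` and `q` to `-e`. The
  -- point over `-u` must not obstruct the latter box, so `h e < h u`.
  have high : ∀ e ∈ A, e ≠ u → 0 < h e → h e < h u ∧ Linked h A u e ∧ Linked h A q (-e) :=
    fun e hm n1 e0 => by
    have n2 : e ≠ q := by rintro rfl; omega
    have hqe := hgt e hm n1 n2
    have hoe := hodd e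
    have l0 : ¬ Linked h A u (-e) := fun hl => by
      have := hl.2.1
      unfold Central at this
      omega
    have l1 := (hall e hm).resolve_right l0
    have l2 := (cov e hm n1 n2).2.resolve_left l0
    have := nq e hqe
    have := l2.not_between_neg hodd hu
    exact ⟨by omega, l1, l2⟩
  have highmono : ∀ e ∈ A, ∀ e' ∈ A, e ≠ u → 0 < h e → 0 < h e' → e < e' → h e < h e' :=
    fun e hm e' hm' n1 e0 e0' hlt => by
    have := hmin e hm
    have := high e hm n1 e0
    have b := (high e' hm' (by omega) e0').2.1.not_between hm
    have : h e ≠ h e' := fun e'' => hlt.ne (hinj e'')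
    omega
  have lowmono : ∀ e ∈ A, ∀ e' ∈ A, e ≠ q → e' ≠ q → h e < 0 → h e' < 0 → e < e' → h e < h e' :=
    fun e hm e' hm' n1 n1' e0 e0' hlt => by
    have := low e hm n1 e0
    have := hgt e hm (by rintro rfl; omega) n1
    have b := (low e' hm' n1' e0').2.not_between hm
    have : h e ≠ h e' := fun e'' => hlt.ne (hinj e'')
    omega
  -- Apart from `u` and `q`, the points over `A` form two increasing sequences: `L`, below the
  -- height of `q`, and `H`, between the heights 0 and `h u`.
  set L := A.filter (fun e => h e < 0 ∧ e ≠ q) with hL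
  set H := A.filter (fun e => 0 < h e ∧ e ≠ u) with hH
  have hLH : A.card = L.card + H.card + 2 := by
    have hA : A = insert u (insert q (L ∪ H)) := by
      ext e
      simp only [hL, hH, Finset.mem_insert, Finset.mem_union, Finset.mem_filter]
      constructor
      · intro hm
        have := hne0 e hm
        simp only [hm, true_and]
        omega
      · rintro (rfl | rfl | hm | hm)
        exacts [hu, hq, hm.1, hm.1]
    have hdis : Disjoint L H := by
      rw [Finset.disjoint_left]
      intro e h1 h2
      simp only [hL, hH, Finset.mem_filter] at h1 h2
      omega
    rw [← Finset.card_union_of_disjoint hdis]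
    conv_lhs => rw [hA]
    rw [Finset.card_insert_of_notMem, Finset.card_insert_of_notMem]
    · simp only [hL, hH, Finset.mem_union, Finset.mem_filter]
      omega
    · simp only [hL, hH, Finset.mem_insert, Finset.mem_union, Finset.mem_filter]
      omega
  by_cases hLe : L.Nonempty
  -- The rightmost point of `L` has at most `2 + (L.card - 1) + H.card + 1 = A.card` neighbours:
  -- `-u`, `q`, other points of `L`, points of `H`, and at most one point opposite to `H`.
  · obtain ⟨s, hs, hsmax⟩ := L.exists_max_image id hLe
    simp only [hL, Finset.mem_filter, id] at hs hsmax
    refine ⟨s, hs.1, ?_⟩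
    have sq := hgt s hs.1 (by rintro rfl; omega) hs.2.2
    have slow := low s hs.1 hs.2.2 hs.2.1
    set P := (L.erase s).filter (fun e => Linked h A s e) with hP
    set Q := H.filter (fun e => Linked h A s (-e)) with hQ
    have hPle : P.card ≤ 1 := by
      refine Finset.card_le_one.2 fun a ha b hb => ?_
      simp only [hP, hL, Finset.mem_filter, Finset.mem_erase] at ha hb
      have sa := hsmax a ha.1.2
      have sb := hsmax b hb.1.2
      have ma := lowmono a ha.1.2.1 s hs.1 ha.1.2.2.2 hs.2.2 ha.1.2.2.1 hs.2.1 (by omega)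
      have mb := lowmono b hb.1.2.1 s hs.1 hb.1.2.2.2 hs.2.2 hb.1.2.2.1 hs.2.1 (by omega)
      have b1 := ha.2.not_between hb.1.2.1
      have b2 := hb.2.not_between ha.1.2.1
      rcases lt_trichotomy a b with hlt | e | hlt
      · have := lowmono a ha.1.2.1 b hb.1.2.1 ha.1.2.2.2 hb.1.2.2.2 ha.1.2.2.1 hb.1.2.2.1 hlt
        omega
      · exact e
      · have := lowmono b hb.1.2.1 a ha.1.2.1 hb.1.2.2.2 ha.1.2.2.2 hb.1.2.2.1 ha.1.2.2.1 hlt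
        omega
    have hPle' : P.card ≤ L.card - 1 := by
      rw [← Finset.card_erase_of_mem (s := L) (a := s) (by simp [hL, hs])]
      exact Finset.card_filter_le _ _
    have hLpos := Finset.card_pos.2 hLe
    have hQle : Q.card ≤ 1 := by
      -- For `a < b` in `Q`, the link of `s` and `-a` places `-a` below `q`; then `-a` obstructs the
      -- box of `q` and `-b`.
      have key : ∀ a ∈ Q, ∀ b ∈ Q, ¬ a < b := fun a ha b hb hlt => by
        simp only [hQ, hH, Finset.mem_filter] at ha hb
        have m := highmono a ha.1.1 b hb.1.1 ha.1.2.2 ha.1.2.1 hb.1.2.1 hlt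
        have b1 := ha.2.not_between hq
        have b2 := (high b hb.1.1 hb.1.2.2 hb.1.2.1).2.2.not_between_neg hodd ha.1.1
        have := hodd a
        have := hodd b
        have := hpos a ha.1.1
        have := hpos q hq
        have : h a ≠ -h q := fun e => by
          have := hinj (e.trans (hodd q).symm)
          omega
        omega
      refine Finset.card_le_one.2 fun a ha b hb => ?_
      have := key a ha b hb
      have := key b hb a ha
      omega
    have hsub : linkNbrs h A s ⊆ {-u, q} ∪ (P ∪ (H ∪ Q.image (fun a => -a))) := by
      intro r hr
      rw [mem_linkNbrs, mem_signedPoints] at hr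
      obtain ⟨hrA, hl⟩ := hr
      have qp := hpos q hq
      simp only [Finset.mem_union, Finset.mem_insert, Finset.mem_singleton]
      rcases hrA with hrA | hrA
      · have n1 : r ≠ u := by
          rintro rfl
          have := hl.not_between hq
          omega
        have n2 : r ≠ s := hl.1.symm
        have := hne0 r hrA
        simp only [hP, hL, hH, Finset.mem_filter, Finset.mem_erase, hrA, hl]
        rcases eq_or_ne r q with e | e
        · simp [e]
        · simp only [ne_eq, not_false_eq_true, true_and, and_true, e]
          omega
      · obtain ⟨e, rfl⟩ : ∃ e, r = -e := ⟨-r, by simp⟩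
        rw [neg_neg] at hrA
        have := hne0 e hrA
        have ep := hpos e hrA
        have oe := hodd e
        have n1 : e ≠ q := by
          rintro rfl
          have := hl.2.1
          unfold Central at this
          omega
        have n2 : e ≠ s := by
          rintro rfl
          have := hl.not_between hq
          omega
        have n3 : ¬ h e < 0 := fun e0 => by
          have := hl.2.1
          unfold Central at this
          omega
        rcases eq_or_ne e u with rfl | e1
        · simp
        · right; right; right
          refine Finset.mem_image.2 ⟨e, ?_, rfl⟩
          simp only [hQ, hH, Finset.mem_filter, hrA, hl]
          simp only [ne_eq, true_and, and_true]
          omega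
    have c1 := (Finset.card_le_card hsub).trans (Finset.card_union_le _ _)
    have c2 := Finset.card_union_le P (H ∪ Q.image (fun a => -a))
    have c3 := Finset.card_union_le H (Q.image (fun a => -a))
    have c4 := Finset.card_image_le (s := Q) (f := fun a => -a)
    have c5 := Finset.card_le_two (a := -u) (b := q)
    omega
  -- With `L` empty, the rightmost point of `H` sees only `u`, `q`, `-q` and one more point of `H`.
  -- Its loop is obstructed by another point `e` of `H`, so it has at most four neighbours.
  · rw [Finset.not_nonempty_iff_eq_empty] at hLe
    rw [hLe, Finset.card_empty] at hLH
    have hL' : ∀ e ∈ A, e ≠ q → 0 < h e := fun e hm n => by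
      have hmL : e ∉ L := by simp [hLe]
      have := hne0 e hm
      simp only [hL, Finset.mem_filter, hm, true_and] at hmL
      omega
    obtain ⟨s, hs, hsmax⟩ := H.exists_max_image id (Finset.card_pos.1 (by omega))
    obtain ⟨e, hem, hes⟩ := Finset.exists_mem_ne (by omega : 1 < H.card) s
    have hes' := hsmax e hem
    simp only [hH, Finset.mem_filter, id] at hs hsmax hem hes'
    refine ⟨s, hs.1, ?_⟩
    have sq := hgt s hs.1 hs.2.2 (by rintro rfl; omega)
    have qp := hpos q hq
    set P := (H.erase s).filter (fun e => Linked h A s e) with hP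
    have hPle : P.card ≤ 1 := by
      refine Finset.card_le_one.2 fun a ha b hb => ?_
      simp only [hP, hH, Finset.mem_filter, Finset.mem_erase] at ha hb
      have sa := hsmax a ha.1.2
      have sb := hsmax b hb.1.2
      have ma := highmono a ha.1.2.1 s hs.1 ha.1.2.2.2 ha.1.2.2.1 hs.2.1 (by omega)
      have mb := highmono b hb.1.2.1 s hs.1 hb.1.2.2.2 hb.1.2.2.1 hs.2.1 (by omega)
      have b1 := ha.2.not_between hb.1.2.1
      have b2 := hb.2.not_between ha.1.2.1
      rcases lt_trichotomy a b with hlt | e | hlt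
      · have := highmono a ha.1.2.1 b hb.1.2.1 ha.1.2.2.2 ha.1.2.2.1 hb.1.2.2.1 hlt
        omega
      · exact e
      · have := highmono b hb.1.2.1 a ha.1.2.1 hb.1.2.2.2 hb.1.2.2.1 ha.1.2.2.1 hlt
        omega
    have hsub : linkNbrs h A s ⊆ {u, q, -q} ∪ P := by
      intro r hr
      rw [mem_linkNbrs, mem_signedPoints] at hr
      obtain ⟨hrA, hl⟩ := hr
      simp only [Finset.mem_union, Finset.mem_insert, Finset.mem_singleton]
      rcases hrA with hrA | hrA
      · have n2 : r ≠ s := hl.1.symm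
        have := hL' r hrA
        simp only [hP, hH, Finset.mem_filter, Finset.mem_erase, hrA, hl]
        simp only [ne_eq, true_and, and_true]
        omega
      · obtain ⟨f, rfl⟩ : ∃ f, r = -f := ⟨-r, by simp⟩
        rw [neg_neg] at hrA
        have := hL' f hrA
        have fp := hpos f hrA
        have oe := hodd f
        have n2 : f ≠ s := by
          rintro rfl
          have := hl.not_between hem.1
          have := hpos e hem.1
          have := highmono e hem.1 f hs.1 hem.2.2 hem.2.1 hs.2.1 (by omega)
          omega
        have := hl.2.1
        unfold Central at this
        omega
    have c1 := (Finset.card_le_card hsub).trans (Finset.card_union_le _ _)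
    have c5 := Finset.card_le_three (a := u) (b := q) (c := -q)
    omega

end SmallGaps

/-! ### Induction on the number of points. -/

/-- The inductive step for the number of linked pairs. -/
theorem card_linkPairs_step {h : ℤ → ℤ} {A : Finset ℤ} (hodd : ∀ k, h (-k) = -h k)
    (hinj : Function.Injective h) (hpos : ∀ a ∈ A, 0 < a) (hcard : 4 ≤ A.card) :
    (∃ p ∈ A, (linkNbrs h A p).card ≤ A.card + (if Even A.card then 1 else 0)) ∨
    (Odd A.card ∧ ∃ p ∈ A, ∃ q ∈ A, p ≠ q ∧
      (linkNbrs h A p).card + (linkNbrs h A q \ {p, -p}).card ≤ 2 * A.card) := by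
  obtain ⟨u, hu, hmin⟩ := A.exists_min_image id (Finset.card_pos.1 (by omega))
  simp only [id] at hmin
  wlog hu0 : 0 < h u generalizing h
  · have hn0 := ne_zero_of_odd hodd hinj (hpos u hu).ne'
    have := this (h := fun k => -h k) (fun k => by simp [hodd])
      (fun a b e => hinj (neg_injective e)) (by omega)
    simpa only [linkNbrs_flip] using this
  obtain ⟨p, q, hc, hgap⟩ := exists_consecutive_max_gap (A := A) h (by omega)
  have hp := hc.1
  have hpq := hc.2.2.1
  by_cases hT : (linkNbrs h A p).card + (linkNbrs h A q \ {p, -p}).card ≤ 2 * A.card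
  · rcases Nat.even_or_odd A.card with hev | hod
    · left
      rw [if_pos hev]
      by_contra hcon
      push Not at hcon
      have h1 := hcon p hp
      have h2 := hcon q hc.2.1
      have h3 := Finset.card_le_card_sdiff_add_card (s := linkNbrs h A q) (t := {p, -p})
      have h4 := Finset.card_le_two (a := p) (b := -p)
      omega
    · exact Or.inr ⟨hod, p, hp, q, hc.2.1, hpq.ne, hT⟩
  push Not at hT
  have hau := abs_of_pos hu0
  -- A gap of at least `2 * h u` would make `p, q` exceptional, and `Exceptional.gap_lt` forbids
  -- this.
  have hsmall : |h p - h q| < 2 * h u := by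
    by_contra hcon
    obtain ⟨R, hR⟩ := card_nbrs_pair_le hodd hinj hpos hc hgap hu hmin (by omega) hT
    have := hR.gap_lt hodd hinj hpos hp hpq hu hmin
    omega
  have hgap' : ∀ s t, Consecutive A s t → |h s - h t| < 2 * h u := fun s t hst =>
    (hgap s t hst).trans_lt hsmall
  obtain ⟨hle, hfull⟩ := card_linkNbrs_min_le hodd hinj hpos hu hmin hu0 hgap'
  left
  by_cases hev : Even A.card
  · exact ⟨u, hu, by rwa [if_pos hev]⟩
  simp only [if_neg hev, add_zero]
  by_contra hcon
  push Not at hcon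
  obtain ⟨hall, c, hcA, l1, l2⟩ := hfull (hcon u hu)
  -- As `h c < 0`, the maximal gap is at least `h u - h c > h u`, so the pair bound applies again
  -- and makes `p, q` exceptional.
  have hcneg := (double_nbr_of_gap_lt hodd hinj hpos hu hmin hu0 hgap' hcA l1 l2).2.1
  obtain ⟨s, t, hst, hstD⟩ := exists_gap_of_double hodd hinj hpos hu hmin hu0 hgap' hcA l1 l2
  have hD := hstD.trans (hgap s t hst)
  obtain ⟨R, hR⟩ := card_nbrs_pair_le hodd hinj hpos hc hgap hu hmin (by omega) hT
  have hpu := hR.eq_min hodd hinj hpos hu hmin hu0 hgap' hp hpq hcA l1 l2 hD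
  subst hpu
  obtain ⟨s, hs, hsle⟩ := hR.exists_card_linkNbrs_le hodd hinj hpos hu hmin hu0 hc hall hcard
  have := hcon s hs
  omega

/-- The upper bound for the number of linked pairs, given the case of five points. -/
theorem card_linkPairs_le_of_five {h : ℤ → ℤ} (hodd : ∀ k, h (-k) = -h k)
    (hinj : Function.Injective h)
    (hfive : ∀ A : Finset ℤ, (∀ a ∈ A, 0 < a) → A.card = 5 → (linkPairs h A).card ≤ 16)
    (n : ℕ) : 5 ≤ n → ∀ A : Finset ℤ, (∀ a ∈ A, 0 < a) → A.card = n →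
      (linkPairs h A).card ≤ n ^ 2 / 2 + n - 1 := by
  induction n using Nat.strong_induction_on with
  | _ n ih =>
  intro hn A hpos hA
  rcases hn.eq_or_lt with rfl | hn'
  · simpa using hfive A hpos hA
  have herase : ∀ p ∈ A, (A.erase p).card = n - 1 := fun p hp => by
    rw [Finset.card_erase_of_mem hp, hA]
  have hpos' : ∀ p, ∀ a ∈ A.erase p, 0 < a := fun p a ha => hpos a (Finset.mem_of_mem_erase ha)
  -- The bound grows by `n + 1` from `n - 1` to an even `n`, by `n` to an odd `n`, and by `2 n` from
  -- `n - 2` to an odd `n`. In the last case `n ≥ 7`, so the induction does not fall below five.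
  rcases card_linkPairs_step hodd hinj hpos (by omega) with ⟨p, hp, hle⟩ | ⟨hod, p, hp, q, hq, hpq, hle⟩
  · have h1 := card_linkPairs_le_erase hodd hpos hp
    have h2 := ih (n - 1) (by omega) (by omega) _ (hpos' p) (herase p hp)
    rw [hA] at hle
    rcases Nat.even_or_odd' n with ⟨m, rfl | rfl⟩
    · rw [if_pos (even_two_mul m)] at hle
      obtain ⟨l, rfl⟩ : ∃ l, m = l + 1 := ⟨m - 1, by omega⟩
      have e1 : (2 * (l + 1)) ^ 2 / 2 = 2 * (l * l) + 4 * l + 2 := by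
        rw [show (2 * (l + 1)) ^ 2 = 2 * (2 * (l * l) + 4 * l + 2) by ring]; omega
      have e2 : (2 * (l + 1) - 1) ^ 2 / 2 = 2 * (l * l) + 2 * l := by
        rw [show 2 * (l + 1) - 1 = 2 * l + 1 by omega,
          show (2 * l + 1) ^ 2 = 2 * (2 * (l * l) + 2 * l) + 1 by ring]; omega
      omega
    · rw [if_neg (by simp)] at hle
      have e1 : (2 * m + 1) ^ 2 / 2 = 2 * (m * m) + 2 * m := by
        rw [show (2 * m + 1) ^ 2 = 2 * (2 * (m * m) + 2 * m) + 1 by ring]; omega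
      have e2 : (2 * m + 1 - 1) ^ 2 / 2 = 2 * (m * m) := by
        rw [show 2 * m + 1 - 1 = 2 * m by omega,
          show (2 * m) ^ 2 = 2 * (2 * (m * m)) by ring]; omega
      omega
  · have h1 := card_linkPairs_le_erase_erase hodd hpos hp hq
    rw [hA] at hod hle
    obtain ⟨m, rfl⟩ := hod
    have h2 := ih (2 * m + 1 - 2) (by omega) (by omega) ((A.erase p).erase q)
      (fun a ha => hpos' p a (Finset.mem_of_mem_erase ha)) (by
        rw [Finset.card_erase_of_mem (Finset.mem_erase.2 ⟨hpq.symm, hq⟩), herase p hp]; omega)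
    obtain ⟨l, rfl⟩ : ∃ l, m = l + 1 := ⟨m - 1, by omega⟩
    have e1 : (2 * (l + 1) + 1) ^ 2 / 2 = 2 * (l * l) + 6 * l + 4 := by
        rw [show (2 * (l + 1) + 1) ^ 2 = 2 * (2 * (l * l) + 6 * l + 4) + 1 by ring]; omega
    have e2 : (2 * (l + 1) + 1 - 2) ^ 2 / 2 = 2 * (l * l) + 2 * l := by
        rw [show 2 * (l + 1) + 1 - 2 = 2 * l + 1 by omega,
          show (2 * l + 1) ^ 2 = 2 * (2 * (l * l) + 2 * l) + 1 by ring]; omega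
    omega

/-! ### The base case of five points. -/

section FivePoints

/-- No entry of `l` lies strictly between `x` and `y`. -/
def clear (x y : ℕ) (l : List ℕ) : Bool := l.all fun k => Nat.ble k x == Nat.ble k y

/-- `clear`, for `x` and `y` on the same side of `5`. -/
def clearSame (x y : ℕ) (l : List ℕ) : Bool := (Nat.ble 5 x == Nat.ble 5 y) && clear x y l

/-- The tests for linked pairs among five points and their opposites, in terms of the ranks of the
heights of the five points among all ten heights. -/
def pairTests (a b c d e : ℕ) : List Bool :=
  [clear (9 - e) e [9 - d, 9 - c, 9 - b, 9 - a, a, b, c, d],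
   clear (9 - d) d [9 - c, 9 - b, 9 - a, a, b, c],
   clearSame (9 - d) e [9 - c, 9 - b, 9 - a, a, b, c, d],
   clear (9 - c) c [9 - b, 9 - a, a, b],
   clearSame (9 - c) d [9 - b, 9 - a, a, b, c],
   clearSame (9 - c) e [9 - b, 9 - a, a, b, c, d],
   clear (9 - b) b [9 - a, a],
   clearSame (9 - b) c [9 - a, a, b],
   clearSame (9 - b) d [9 - a, a, b, c],
   clearSame (9 - b) e [9 - a, a, b, c, d],
   clear (9 - a) a [],
   clearSame (9 - a) b [a],
   clearSame (9 - a) c [a, b],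
   clearSame (9 - a) d [a, b, c],
   clearSame (9 - a) e [a, b, c, d],
   clear a b [],
   clear a c [b],
   clear a d [b, c],
   clear a e [b, c, d],
   clear b c [],
   clear b d [c],
   clear b e [c, d],
   clear c d [],
   clear c e [d],
   clear d e []]

/-- The ranks `a` and `b` belong neither to the same nor to opposite points. -/
def fresh (a b : ℕ) : Bool := !(Nat.beq a b || Nat.beq (a + b) 9)

/-- At most `n` entries of the list are `true`. -/
def countLe : ℕ → List Bool → Bool
  | _, [] => true
  | 0, b :: l => !b && countLe 0 l
  | n + 1, b :: l => bif b then countLe n l else countLe (n + 1) l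

/-- Among five points there are at most 16 linked pairs, by inspection of all relative
positions. -/
def fivePointCheck : Bool :=
  let l := [0, 1, 2, 3, 4, 5, 6, 7, 8, 9]
  [5, 6, 7, 8, 9].all fun a => (l.filter (fresh a)).all fun b =>
    ((l.filter (fresh a)).filter (fresh b)).all fun c =>
      (((l.filter (fresh a)).filter (fresh b)).filter (fresh c)).all fun d =>
        ((((l.filter (fresh a)).filter (fresh b)).filter (fresh c)).filter (fresh d)).all fun e =>
          countLe 16 (pairTests a b c d e)

/-- There are `5 * 8 * 6 * 4 * 2 = 1920` cases: the first height is taken positive, and each further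
rank avoids the pairs `x, 9 - x` already used. -/
theorem fivePointCheck_eq_true : fivePointCheck = true := by decide +kernel

theorem count_le_of_countLe {n : ℕ} {l : List Bool} (hl : countLe n l = true) :
    (l.filter id).length ≤ n := by
  induction l generalizing n with
  | nil => simp
  | cons b l ih =>
    cases n with
    | zero =>
      simp only [countLe, Bool.and_eq_true, Bool.not_eq_true'] at hl
      have := ih hl.2
      simpa [hl.1] using this
    | succ n =>
      cases b with
      | true =>
        have := ih (n := n) (by simpa [countLe] using hl)
        simpa using this
      | false =>
        have := ih (n := n + 1) (by simpa [countLe] using hl)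
        simpa using this

theorem countLe_pairTests {a b c d e : ℕ} (ha : 5 ≤ a) (ha' : a ≤ 9) (hb : b ≤ 9) (hc : c ≤ 9)
    (hd : d ≤ 9) (he : e ≤ 9) (hab : fresh a b) (hac : fresh a c) (had : fresh a d)
    (hae : fresh a e) (hbc : fresh b c) (hbd : fresh b d) (hbe : fresh b e) (hcd : fresh c d)
    (hce : fresh c e) (hde : fresh d e) : countLe 16 (pairTests a b c d e) = true := by
  have hmem : ∀ x, x ≤ 9 → x ∈ [0, 1, 2, 3, 4, 5, 6, 7, 8, 9] := by
    intro x hx; interval_cases x <;> simp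
  have hmem' : a ∈ [5, 6, 7, 8, 9] := by interval_cases a <;> simp
  have h := fivePointCheck_eq_true
  simp only [fivePointCheck, List.all_eq_true, List.mem_filter] at h
  exact h a hmem' b ⟨hmem b hb, hab⟩ c ⟨⟨hmem c hc, hac⟩, hbc⟩ d ⟨⟨⟨hmem d hd, had⟩, hbd⟩, hcd⟩
    e ⟨⟨⟨⟨hmem e he, hae⟩, hbe⟩, hce⟩, hde⟩

theorem length_filter_le_of_forall₂ {α : Type*} {P : α → Bool} {l : List α} {t : List Bool}
    (h : List.Forall₂ (fun x b => P x = true → b = true) l t) :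
    (l.filter P).length ≤ (t.filter id).length := by
  induction h with
  | nil => simp
  | @cons x b l t hxb _ ih =>
    rcases hx : P x with _ | _
    · cases b <;> simp [hx] <;> omega
    · simp [hx, hxb hx, ih]

/-- The rank of the height of `k` among the heights over `±A`. -/
def heightRank (h : ℤ → ℤ) (A : Finset ℤ) (k : ℤ) : ℕ :=
  ((signedPoints A).filter fun s => h s < h k).card

variable {h : ℤ → ℤ} {A : Finset ℤ} {k l : ℤ}

theorem heightRank_lt (hk : k ∈ signedPoints A) (hkl : h k < h l) :
    heightRank h A k < heightRank h A l := by
  refine Finset.card_lt_card ⟨fun s hs => ?_, fun hs => ?_⟩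
  · rw [Finset.mem_filter] at *
    exact ⟨hs.1, hs.2.trans hkl⟩
  · have := hs (Finset.mem_filter.2 ⟨hk, hkl⟩)
    simp at this

theorem heightRank_le_iff (hl : l ∈ signedPoints A) :
    heightRank h A k ≤ heightRank h A l ↔ h k ≤ h l := by
  constructor
  · intro hle
    by_contra hcon
    have := heightRank_lt (h := h) hl (not_le.1 hcon)
    omega
  · intro hle
    refine Finset.card_le_card fun s hs => ?_
    rw [Finset.mem_filter] at *
    exact ⟨hs.1, hs.2.trans_le hle⟩

/-- Negation reverses the order of the heights, which are distinct. -/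
theorem heightRank_neg (hodd : ∀ k, h (-k) = -h k) (hinj : Function.Injective h)
    (hk : k ∈ signedPoints A) :
    heightRank h A (-k) + heightRank h A k + 1 = (signedPoints A).card := by
  have h1 : heightRank h A (-k) = ((signedPoints A).filter fun s => h k < h s).card := by
    refine Finset.card_bij (fun s _ => -s) (fun s hs => ?_) (fun s _ t _ e => neg_injective e)
      (fun s hs => ⟨-s, ?_, neg_neg s⟩) <;>
    · rw [Finset.mem_filter] at *
      refine ⟨neg_mem_signedPoints hs.1, ?_⟩
      have := hs.2
      have := hodd s
      have := hodd k
      omega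
  have h2 := Finset.card_filter_add_card_filter_not (s := (signedPoints A).erase k)
    (fun s => h s < h k)
  have h3 : ((signedPoints A).erase k).filter (fun s => h s < h k) =
      (signedPoints A).filter fun s => h s < h k := by
    ext s; simp only [Finset.mem_filter, Finset.mem_erase]
    constructor
    · tauto
    · rintro ⟨a, b⟩
      exact ⟨⟨by rintro rfl; omega, a⟩, b⟩
  have h4 : ((signedPoints A).erase k).filter (fun s => ¬ h s < h k) =
      (signedPoints A).filter fun s => h k < h s := by
    ext s; simp only [Finset.mem_filter, Finset.mem_erase]
    constructor
    · rintro ⟨⟨a, b⟩, c⟩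
      have : h s ≠ h k := fun e => a (hinj e)
      exact ⟨b, by omega⟩
    · rintro ⟨a, b⟩
      exact ⟨⟨by rintro rfl; omega, a⟩, by omega⟩
  rw [h3, h4, Finset.card_erase_of_mem hk] at h2
  have := Finset.card_pos.2 ⟨k, hk⟩
  rw [h1, heightRank]
  omega

/-- Emptiness of a box depends only on relative order, so it can be read off from ranks. For an
upper bound only this implication is needed. -/
theorem Linked.clear (hinj : Function.Injective h) {p r : ℤ} (hl : Linked h A p r)
    (hp : p ∈ signedPoints A) (hr : r ∈ signedPoints A) {l : List ℤ}
    (hm : ∀ k ∈ l, k ∈ signedPoints A) (hb : ∀ k ∈ l, p < k ∧ k < r) :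
    clear (heightRank h A p) (heightRank h A r) (l.map (heightRank h A)) = true := by
  simp only [_root_.clear, List.all_eq_true, List.mem_map, forall_exists_index, and_imp,
    forall_apply_eq_imp_iff₂, beq_iff_eq]
  intro k hk
  rw [Bool.eq_iff_iff, Nat.ble_eq, Nat.ble_eq, heightRank_le_iff hp, heightRank_le_iff hr]
  have h1 := hl.2.2 k (mem_signedPoints.1 (hm k hk))
  have h2 := hb k hk
  have h3 : h k ≠ h p := fun e => h2.1.ne' (hinj e)
  have h4 : h k ≠ h r := fun e => h2.2.ne (hinj e)
  unfold InBox at h1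
  omega

theorem Linked.clearSame (hodd : ∀ k, h (-k) = -h k) (hinj : Function.Injective h)
    (hcard : (signedPoints A).card = 10) {p r : ℤ} (hl : Linked h A p r)
    (hp : p ∈ signedPoints A) (hr : r ∈ signedPoints A) {l : List ℤ}
    (hm : ∀ k ∈ l, k ∈ signedPoints A) (hb : ∀ k ∈ l, p < k ∧ k < r)
    (hp0 : p < 0) (hr0 : 0 < r) (hne : r ≠ -p) :
    clearSame (heightRank h A p) (heightRank h A r) (l.map (heightRank h A)) = true := by
  have side : ∀ k ∈ signedPoints A, 5 ≤ heightRank h A k ↔ 0 < h k := by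
    intro k hk
    have h1 := heightRank_neg hodd hinj hk
    have h2 := heightRank_le_iff (h := h) (k := k) (neg_mem_signedPoints hk)
    rw [hodd] at h2
    omega
  simp only [_root_.clearSame, Bool.and_eq_true, beq_iff_eq]
  refine ⟨?_, hl.clear hinj hp hr hm hb⟩
  rw [Bool.eq_iff_iff, Nat.ble_eq, Nat.ble_eq, side p hp, side r hr]
  have h1 := hl.2.1
  have h2 := ne_zero_of_odd hodd hinj hp0.ne
  have h3 := ne_zero_of_odd hodd hinj hr0.ne'
  unfold Central at h1
  omega

theorem exists_eq_of_card_eq_five (hA : A.card = 5) : ∃ a b c d e, a < b ∧ b < c ∧ c < d ∧ d < e ∧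
    A = {a, b, c, d, e} := by
  have hm := (A.orderEmbOfFin hA).strictMono
  refine ⟨A.orderEmbOfFin hA 0, A.orderEmbOfFin hA 1, A.orderEmbOfFin hA 2,
    A.orderEmbOfFin hA 3, A.orderEmbOfFin hA 4, hm (by decide), hm (by decide), hm (by decide),
    hm (by decide), ?_⟩
  rw [← Finset.coe_inj, ← Finset.range_orderEmbOfFin A hA]
  ext x
  simp only [Set.mem_range, Finset.coe_insert, Finset.coe_singleton, Set.mem_insert_iff,
    Set.mem_singleton_iff, Fin.exists_fin_succ, Fin.exists_fin_zero]
  simp [eq_comm]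

theorem card_linkPairs_le_of_card_eq_five (hodd : ∀ k, h (-k) = -h k)
    (hinj : Function.Injective h) (hpos : ∀ a ∈ A, 0 < a) (hA : A.card = 5) :
    (linkPairs h A).card ≤ 16 := by
  classical
  have hS : (signedPoints A).card = 10 := by rw [card_signedPoints hpos, hA]
  obtain ⟨a, b, c, d, e, hab, hbc, hcd, hde, hAe⟩ := exists_eq_of_card_eq_five hA
  have hmA : ∀ k, k ∈ A ↔ k = a ∨ k = b ∨ k = c ∨ k = d ∨ k = e := by simp [hAe]
  have a0 : 0 < a := hpos a (by simp [hmA])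
  -- Flipping all heights halves the enumeration: the rank of the leftmost point may be taken to be
  -- at least 5.
  wlog ha0 : 0 < h a generalizing h
  · rw [← linkPairs_flip]
    have hne := ne_zero_of_odd hodd hinj a0.ne'
    exact this (h := fun k => -h k) (fun k => by simp [hodd]) (fun a b e => hinj (neg_injective e))
      (by omega)
  have hmS : ∀ k, (k = a ∨ k = b ∨ k = c ∨ k = d ∨ k = e ∨ k = -a ∨ k = -b ∨ k = -c ∨ k = -d ∨
      k = -e) → k ∈ signedPoints A := by
    intro k hk
    rw [mem_signedPoints, hmA, hmA]
    omega
  set ρ := heightRank h A with hρ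
  have neg : ∀ k ∈ signedPoints A, 9 - ρ k = ρ (-k) := fun k hk => by
    have h1 := heightRank_neg hodd hinj hk
    change ρ (-k) + ρ k + 1 = _ at h1
    omega
  have le9 : ∀ k ∈ signedPoints A, ρ k ≤ 9 := fun k hk => by
    have h1 := heightRank_neg hodd hinj hk
    change ρ (-k) + ρ k + 1 = _ at h1
    omega
  have hfresh : ∀ k ∈ signedPoints A, ∀ l ∈ signedPoints A, 0 < k → k < l → fresh (ρ k) (ρ l) := by
    intro k hk l hl hk0 hkl
    rw [fresh, Bool.not_eq_true', Bool.or_eq_false_iff, ← Bool.not_eq_true, ← Bool.not_eq_true,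
      Nat.beq_eq, Nat.beq_eq]
    refine ⟨fun e => ?_, fun e => ?_⟩
    · have h1 := (heightRank_le_iff (h := h) hl).1 e.le
      have h2 := (heightRank_le_iff (h := h) hk).1 e.ge
      exact hkl.ne (hinj (le_antisymm h1 h2))
    · have e' : ρ k = ρ (-l) := by rw [← neg l hl]; omega
      have h1 := (heightRank_le_iff (h := h) (neg_mem_signedPoints hl)).1 e'.le
      have h2 := (heightRank_le_iff (h := h) hk).1 e'.ge
      have := hinj (le_antisymm h1 h2)
      omega
  have ma := hmS a (by simp)
  have mb := hmS b (by simp)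
  have mc := hmS c (by simp)
  have md := hmS d (by simp)
  have me := hmS e (by simp)
  have ha5 : 5 ≤ ρ a := by
    have h1 := heightRank_neg hodd hinj ma
    have h2 := heightRank_lt (h := h) (l := a) (neg_mem_signedPoints ma) (by rw [hodd]; omega)
    change ρ (-a) < ρ a at h2
    change ρ (-a) + ρ a + 1 = _ at h1
    omega
  have hcount := count_le_of_countLe (countLe_pairTests ha5 (le9 a ma) (le9 b mb) (le9 c mc)
    (le9 d md) (le9 e me) (hfresh a ma b mb a0 hab) (hfresh a ma c mc a0 (by omega))
    (hfresh a ma d md a0 (by omega)) (hfresh a ma e me a0 (by omega))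
    (hfresh b mb c mc (by omega) hbc) (hfresh b mb d md (by omega) (by omega))
    (hfresh b mb e me (by omega) (by omega)) (hfresh c mc d md (by omega) hcd)
    (hfresh c mc e me (by omega) (by omega)) (hfresh d md e me (by omega) hde))
  refine le_trans ?_ hcount
  let l : List (ℤ × ℤ) :=
    [(-e, e), (-d, d), (-d, e), (-c, c), (-c, d), (-c, e), (-b, b), (-b, c), (-b, d), (-b, e),
     (-a, a), (-a, b), (-a, c), (-a, d), (-a, e), (a, b), (a, c), (a, d), (a, e), (b, c), (b, d),
     (b, e), (c, d), (c, e), (d, e)]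
  have hsub : linkPairs h A ⊆ (l.filter fun x => decide (Linked h A x.1 x.2)).toFinset := by
    rintro ⟨x, y⟩ hxy
    obtain ⟨hx, hy, hlt, hs, hl⟩ := mem_linkPairs.1 hxy
    rw [List.mem_toFinset, List.mem_filter]
    refine ⟨?_, by simpa using hl⟩
    rw [mem_signedPoints, hmA, hmA] at hx hy
    simp only at hlt hs
    have hy' : y = a ∨ y = b ∨ y = c ∨ y = d ∨ y = e := by omega
    have hx' : x = a ∨ x = b ∨ x = c ∨ x = d ∨ x = e ∨ x = -a ∨ x = -b ∨ x = -c ∨ x = -d ∨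
      x = -e := by omega
    clear hx hy
    rcases hy' with rfl | rfl | rfl | rfl | rfl <;>
    rcases hx' with rfl | rfl | rfl | rfl | rfl | rfl | rfl | rfl | rfl | rfl <;>
    first
    | (exfalso; omega)
    | (repeat first | exact List.Mem.head _ | apply List.Mem.tail)
  refine (Finset.card_le_card hsub).trans ((List.toFinset_card_le _).trans
    (length_filter_le_of_forall₂ ?_))
  have tc : ∀ {p r : ℤ} {l : List ℤ}, p ∈ signedPoints A → r ∈ signedPoints A →
      (∀ k ∈ l, k ∈ signedPoints A) → (∀ k ∈ l, p < k ∧ k < r) →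
      decide (Linked h A p r) = true → clear (ρ p) (ρ r) (l.map ρ) = true :=
    fun hp hr hm hb hl => (of_decide_eq_true hl).clear hinj hp hr hm hb
  have ts : ∀ {p r : ℤ} {l : List ℤ}, p ∈ signedPoints A → r ∈ signedPoints A →
      (∀ k ∈ l, k ∈ signedPoints A) → (∀ k ∈ l, p < k ∧ k < r) → p < 0 → 0 < r → r ≠ -p →
      decide (Linked h A p r) = true → clearSame (ρ p) (ρ r) (l.map ρ) = true :=
    fun hp hr hm hb h0 h1 h2 hl => (of_decide_eq_true hl).clearSame hodd hinj hS hp hr hm hb h0 h1 h2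
  have mems : ∀ l : List ℤ, (∀ k ∈ l, k = a ∨ k = b ∨ k = c ∨ k = d ∨ k = e ∨ k = -a ∨ k = -b ∨
      k = -c ∨ k = -d ∨ k = -e) → ∀ k ∈ l, k ∈ signedPoints A := fun l hl k hk => hmS k (hl k hk)
  simp only [pairTests, neg a ma, neg b mb, neg c mc, neg d md, neg e me]
  have na := neg_mem_signedPoints ma
  have nb := neg_mem_signedPoints mb
  have nc := neg_mem_signedPoints mc
  have nd := neg_mem_signedPoints md
  have ne := neg_mem_signedPoints me
  repeat' first
    | exact List.Forall₂.nil
    | refine List.Forall₂.cons ?_ ?_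
  · exact tc (l := [-d, -c, -b, -a, a, b, c, d]) (by assumption) (by assumption) (mems _ (by simp)) (by simp; omega)
  · exact tc (l := [-c, -b, -a, a, b, c]) (by assumption) (by assumption) (mems _ (by simp)) (by simp; omega)
  · exact ts (l := [-c, -b, -a, a, b, c, d]) (by assumption) (by assumption) (mems _ (by simp)) (by simp; omega)
      (by omega) (by omega) (by omega)
  · exact tc (l := [-b, -a, a, b]) (by assumption) (by assumption) (mems _ (by simp)) (by simp; omega)
  · exact ts (l := [-b, -a, a, b, c]) (by assumption) (by assumption) (mems _ (by simp)) (by simp; omega)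
      (by omega) (by omega) (by omega)
  · exact ts (l := [-b, -a, a, b, c, d]) (by assumption) (by assumption) (mems _ (by simp)) (by simp; omega)
      (by omega) (by omega) (by omega)
  · exact tc (l := [-a, a]) (by assumption) (by assumption) (mems _ (by simp)) (by simp; omega)
  · exact ts (l := [-a, a, b]) (by assumption) (by assumption) (mems _ (by simp)) (by simp; omega)
      (by omega) (by omega) (by omega)
  · exact ts (l := [-a, a, b, c]) (by assumption) (by assumption) (mems _ (by simp)) (by simp; omega)
      (by omega) (by omega) (by omega)
  · exact ts (l := [-a, a, b, c, d]) (by assumption) (by assumption) (mems _ (by simp)) (by simp; omega)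
      (by omega) (by omega) (by omega)
  · exact tc (l := []) (by assumption) (by assumption) (by simp) (by simp)
  · exact ts (l := [a]) (by assumption) (by assumption) (mems _ (by simp)) (by simp; omega)
      (by omega) (by omega) (by omega)
  · exact ts (l := [a, b]) (by assumption) (by assumption) (mems _ (by simp)) (by simp; omega)
      (by omega) (by omega) (by omega)
  · exact ts (l := [a, b, c]) (by assumption) (by assumption) (mems _ (by simp)) (by simp; omega)
      (by omega) (by omega) (by omega)
  · exact ts (l := [a, b, c, d]) (by assumption) (by assumption) (mems _ (by simp)) (by simp; omega)
      (by omega) (by omega) (by omega)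
  · exact tc (l := []) (by assumption) (by assumption) (by simp) (by simp)
  · exact tc (l := [b]) (by assumption) (by assumption) (mems _ (by simp)) (by simp; omega)
  · exact tc (l := [b, c]) (by assumption) (by assumption) (mems _ (by simp)) (by simp; omega)
  · exact tc (l := [b, c, d]) (by assumption) (by assumption) (mems _ (by simp)) (by simp; omega)
  · exact tc (l := []) (by assumption) (by assumption) (by simp) (by simp)
  · exact tc (l := [c]) (by assumption) (by assumption) (mems _ (by simp)) (by simp; omega)
  · exact tc (l := [c, d]) (by assumption) (by assumption) (mems _ (by simp)) (by simp; omega)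
  · exact tc (l := []) (by assumption) (by assumption) (by simp) (by simp)
  · exact tc (l := [d]) (by assumption) (by assumption) (mems _ (by simp)) (by simp; omega)
  · exact tc (l := []) (by assumption) (by assumption) (by simp) (by simp)

end FivePoints

/-- The number of linked pairs over `±A` for a set `A` of `n ≥ 5` points. -/
theorem card_linkPairs_le {h : ℤ → ℤ} {A : Finset ℤ} (hodd : ∀ k, h (-k) = -h k)
    (hinj : Function.Injective h) (hpos : ∀ a ∈ A, 0 < a) (hA : 5 ≤ A.card) :
    (linkPairs h A).card ≤ A.card ^ 2 / 2 + A.card - 1 :=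
  card_linkPairs_le_of_five hodd hinj
    (fun _ hB hB' => card_linkPairs_le_of_card_eq_five hodd hinj hB hB') _ hA A hpos rfl

/-! ### Inversions of a signed permutation. -/

section Inversions

/-- The number of inversions of `f` on `S`. -/
def invNum (S : Finset ℤ) (f : ℤ → ℤ) : ℕ :=
  ((S ×ˢ S).filter fun x => x.1 < x.2 ∧ f x.2 < f x.1).card

/-- `1` if `f` reverses the order of `x` and `y`, and `0` otherwise. -/
def invInd (f : ℤ → ℤ) (x y : ℤ) : ℕ :=
  if (x < y ∧ f y < f x) ∨ (y < x ∧ f x < f y) then 1 else 0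

variable {S : Finset ℤ} {f : ℤ → ℤ} {a b : ℤ}

theorem invInd_comm (f : ℤ → ℤ) (x y : ℤ) : invInd f x y = invInd f y x := by
  unfold invInd; split_ifs <;> first | rfl | omega

theorem two_mul_invNum (S : Finset ℤ) (f : ℤ → ℤ) :
    2 * invNum S f = ∑ x ∈ S, ∑ y ∈ S, invInd f x y := by
  have h1 : invNum S f = ∑ x ∈ S, ∑ y ∈ S, if x < y ∧ f y < f x then 1 else 0 := by
    rw [invNum, Finset.card_filter, Finset.sum_product]
  have h2 : invNum S f = ∑ x ∈ S, ∑ y ∈ S, if y < x ∧ f x < f y then 1 else 0 := by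
    rw [h1, Finset.sum_comm]
  rw [two_mul]
  conv_lhs => arg 1; rw [h1]
  rw [h2, ← Finset.sum_add_distrib]
  refine Finset.sum_congr rfl fun x _ => ?_
  rw [← Finset.sum_add_distrib]
  refine Finset.sum_congr rfl fun y _ => ?_
  unfold invInd
  split_ifs <;> first | rfl | omega

/-- The doubled count is symmetric in the two positions, so the contributions of `a` and `b` split
off regardless of where the other positions lie. -/
theorem two_mul_invNum_split (f : ℤ → ℤ) (ha : a ∈ S) (hb : b ∈ S) (hab : a ≠ b) :
    2 * invNum S f = (∑ x ∈ (S.erase a).erase b, ∑ y ∈ (S.erase a).erase b, invInd f x y) +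
      2 * (∑ k ∈ (S.erase a).erase b, (invInd f a k + invInd f b k)) + 2 * invInd f a b := by
  have hb' : b ∈ S.erase a := Finset.mem_erase.2 ⟨hab.symm, hb⟩
  have key : ∀ g : ℤ → ℕ, ∑ x ∈ S, g x = ∑ x ∈ (S.erase a).erase b, g x + g a + g b := by
    intro g
    rw [← Finset.sum_erase_add _ _ ha, ← Finset.sum_erase_add _ _ hb']
    ring
  have z : ∀ x, invInd f x x = 0 := fun x => by simp [invInd]
  have c : ∀ z, ∑ x ∈ (S.erase a).erase b, invInd f x z =
      ∑ x ∈ (S.erase a).erase b, invInd f z x :=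
    fun z => Finset.sum_congr rfl fun x _ => invInd_comm f x z
  have inner : ∀ x, ∑ y ∈ S, invInd f x y =
      ∑ y ∈ (S.erase a).erase b, invInd f x y + invInd f x a + invInd f x b :=
    fun x => key _
  rw [two_mul_invNum, key, inner a, inner b, Finset.sum_congr rfl fun x _ => inner x,
    Finset.sum_add_distrib, Finset.sum_add_distrib, Finset.sum_add_distrib, c a, c b, z, z,
    invInd_comm f b a]
  ring

/-- Exchanging two values which are in increasing order. -/
theorem invNum_swap (hinj : Function.Injective f) (ha : a ∈ S) (hb : b ∈ S) (hab : a < b)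
    (hf : f a < f b) : invNum S (f ∘ Equiv.swap a b) = invNum S f + 1 +
      2 * (S.filter fun k => (a < k ∧ k < b) ∧ f a < f k ∧ f k < f b).card := by
  have h1 := two_mul_invNum_split f ha hb hab.ne
  have h2 := two_mul_invNum_split (f ∘ Equiv.swap a b) ha hb hab.ne
  have sk : ∀ k ∈ (S.erase a).erase b, (f ∘ Equiv.swap a b) k = f k := fun k hk => by
    simp only [Finset.mem_erase] at hk
    rw [Function.comp_apply, Equiv.swap_apply_of_ne_of_ne hk.2.1 hk.1]
  have sa : (f ∘ Equiv.swap a b) a = f b := by simp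
  have sb : (f ∘ Equiv.swap a b) b = f a := by simp
  have e1 : ∑ x ∈ (S.erase a).erase b, ∑ y ∈ (S.erase a).erase b,
      invInd (f ∘ Equiv.swap a b) x y =
      ∑ x ∈ (S.erase a).erase b, ∑ y ∈ (S.erase a).erase b, invInd f x y := by
    refine Finset.sum_congr rfl fun x hx => Finset.sum_congr rfl fun y hy => ?_
    rw [invInd, invInd, sk x hx, sk y hy]
  -- A third point adds 2 if it lies strictly inside the box, and its total contribution is
  -- unchanged otherwise.
  have e2 : ∑ k ∈ (S.erase a).erase b, (invInd (f ∘ Equiv.swap a b) a k +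
      invInd (f ∘ Equiv.swap a b) b k) =
      ∑ k ∈ (S.erase a).erase b, (invInd f a k + invInd f b k) +
      2 * (S.filter fun k => (a < k ∧ k < b) ∧ f a < f k ∧ f k < f b).card := by
    have : (S.filter fun k => (a < k ∧ k < b) ∧ f a < f k ∧ f k < f b) =
        ((S.erase a).erase b).filter fun k => (a < k ∧ k < b) ∧ f a < f k ∧ f k < f b := by
      ext k; simp only [Finset.mem_filter, Finset.mem_erase]
      constructor
      · rintro ⟨h, h'⟩; exact ⟨⟨by omega, by omega, h⟩, h'⟩
      · tauto
    rw [this, Finset.card_filter, Finset.mul_sum, ← Finset.sum_add_distrib]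
    refine Finset.sum_congr rfl fun k hk => ?_
    have hk' := hk
    simp only [Finset.mem_erase] at hk'
    have n1 : f k ≠ f a := fun e => hk'.2.1 (hinj e)
    have n2 : f k ≠ f b := fun e => hk'.1 (hinj e)
    simp only [invInd, sk k hk, sa, sb]
    split_ifs <;> omega
  have e3 : invInd (f ∘ Equiv.swap a b) a b = 1 := by
    simp only [invInd, sa, sb]; split_ifs <;> omega
  have e4 : invInd f a b = 0 := by
    simp only [invInd]; split_ifs <;> omega
  rw [e1, e2, e3] at h2
  rw [e4] at h1
  omega

/-- Twice the length of the signed permutation `h` of `±A`. -/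
def signedInv (A : Finset ℤ) (h : ℤ → ℤ) : ℕ :=
  invNum (signedPoints A) h + (A.filter fun k => h k < 0).card

variable {A : Finset ℤ} {h h' : ℤ → ℤ}

theorem card_neg_split (ha : a ∈ A) (hb : b ∈ A) (hab : a ≠ b) :
    (A.filter fun k => h k < 0).card = (((A.erase a).erase b).filter fun k => h k < 0).card +
      (if h a < 0 then 1 else 0) + (if h b < 0 then 1 else 0) := by
  have hb' : b ∈ A.erase a := Finset.mem_erase.2 ⟨hab.symm, hb⟩
  rw [Finset.card_filter, Finset.card_filter, ← Finset.sum_erase_add _ _ ha,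
    ← Finset.sum_erase_add _ _ hb']
  ring

/-- Two ordinary swaps are performed, each adding 1 plus twice the number of points in its box. The
second box is the opposite of the first; the points over `a` and `b`, which have just moved, can
enter it only if the original pair is central. -/
theorem invNum_signedSwap (hodd : ∀ k, h (-k) = -h k) (hinj : Function.Injective h)
    (ha : a ∈ signedPoints A) (hb : b ∈ signedPoints A) (hab : a < b) (hne : a ≠ -b)
    (ha0 : a ≠ 0) (hb0 : b ≠ 0) (hf : h a < h b) :
    invNum (signedPoints A) h + 2 ≤
        invNum (signedPoints A) (h ∘ Equiv.swap a b ∘ Equiv.swap (-a) (-b)) ∧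
      (¬ Central h a b → EmptyBox h A a b →
        invNum (signedPoints A) (h ∘ Equiv.swap a b ∘ Equiv.swap (-a) (-b)) =
          invNum (signedPoints A) h + 2) := by
  have h1 := invNum_swap hinj ha hb hab hf
  have sa : (h ∘ Equiv.swap a b) (-a) = -h a := by
    rw [Function.comp_apply, Equiv.swap_apply_of_ne_of_ne (by omega) (by omega), hodd]
  have sb : (h ∘ Equiv.swap a b) (-b) = -h b := by
    rw [Function.comp_apply, Equiv.swap_apply_of_ne_of_ne (by omega) (by omega), hodd]
  have h2 := invNum_swap (f := h ∘ Equiv.swap a b) (a := -b) (b := -a)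
    (hinj.comp (Equiv.swap a b).injective) (neg_mem_signedPoints hb) (neg_mem_signedPoints ha)
    (by omega) (by rw [sa, sb]; omega)
  rw [Equiv.swap_comm (-b) (-a), Function.comp_assoc] at h2
  refine ⟨by omega, fun hc he => ?_⟩
  have z1 : ((signedPoints A).filter fun k => (a < k ∧ k < b) ∧ h a < h k ∧ h k < h b).card = 0 := by
    rw [Finset.card_eq_zero, Finset.filter_eq_empty_iff]
    intro k hk hk'
    refine he k (mem_signedPoints.1 hk) ?_
    unfold InBox
    omega
  have z2 : ((signedPoints A).filter fun k => (-b < k ∧ k < -a) ∧ (h ∘ Equiv.swap a b) (-b) <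
      (h ∘ Equiv.swap a b) k ∧ (h ∘ Equiv.swap a b) k < (h ∘ Equiv.swap a b) (-a)).card = 0 := by
    rw [Finset.card_eq_zero, Finset.filter_eq_empty_iff]
    intro k hk hk'
    rw [sa, sb] at hk'
    unfold Central at hc
    rcases eq_or_ne k a with rfl | ka
    · simp only [Function.comp_apply, Equiv.swap_apply_left] at hk'
      omega
    rcases eq_or_ne k b with rfl | kb
    · simp only [Function.comp_apply, Equiv.swap_apply_right] at hk'
      omega
    rw [Function.comp_apply, Equiv.swap_apply_of_ne_of_ne ka kb] at hk'
    refine he (-k) (by rw [neg_neg]; exact (mem_signedPoints.1 hk).symm) ?_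
    unfold InBox
    rw [hodd]
    omega
  omega

/-- The number of negative values at positive positions does not decrease, and it changes only for a
central pair; the inversions account for the rest. -/
theorem signedInv_signedSwap (hodd : ∀ k, h (-k) = -h k) (hinj : Function.Injective h)
    (hpos : ∀ a ∈ A, 0 < a)
    (ha : a ∈ signedPoints A) (hb : b ∈ signedPoints A) (hab : a < b) (hne : a ≠ -b)
    (hf : h a < h b) (hh' : h' = h ∘ Equiv.swap a b ∘ Equiv.swap (-a) (-b)) :
    signedInv A h < signedInv A h' ∧ (Linked h A a b → signedInv A h' = signedInv A h + 2) := by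
  rw [mem_signedPoints] at ha hb
  have ha0 : a ≠ 0 := by rintro rfl; rcases ha with m | m <;> simpa using hpos _ m
  have hb0 : b ≠ 0 := by rintro rfl; rcases hb with m | m <;> simpa using hpos _ m
  have h1 := invNum_signedSwap hodd hinj (mem_signedPoints.2 ha) (mem_signedPoints.2 hb) hab hne
    ha0 hb0 hf
  rw [← hh'] at h1
  have va : h' a = h b := by
    rw [hh', Function.comp_apply, Function.comp_apply,
      Equiv.swap_apply_of_ne_of_ne (a := -a) (by omega) (by omega), Equiv.swap_apply_left]
  have vb : h' b = h a := by
    rw [hh', Function.comp_apply, Function.comp_apply,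
      Equiv.swap_apply_of_ne_of_ne (a := -a) (by omega) (by omega), Equiv.swap_apply_right]
  have wa : h' (-a) = -h b := by
    rw [hh', Function.comp_apply, Function.comp_apply, Equiv.swap_apply_left,
      Equiv.swap_apply_of_ne_of_ne (by omega) (by omega), hodd]
  have wb : h' (-b) = -h a := by
    rw [hh', Function.comp_apply, Function.comp_apply, Equiv.swap_apply_right,
      Equiv.swap_apply_of_ne_of_ne (by omega) (by omega), hodd]
  obtain ⟨α, hα, hαa⟩ : ∃ α ∈ A, α = a ∨ α = -a :=
    ha.elim (fun m => ⟨a, m, Or.inl rfl⟩) fun m => ⟨-a, m, Or.inr rfl⟩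
  obtain ⟨β, hβ, hβb⟩ : ∃ β ∈ A, β = b ∨ β = -b :=
    hb.elim (fun m => ⟨b, m, Or.inl rfl⟩) fun m => ⟨-b, m, Or.inr rfl⟩
  have hαβ : α ≠ β := by omega
  have s1 := card_neg_split (h := h) hα hβ hαβ
  have s2 := card_neg_split (h := h') hα hβ hαβ
  have s3 : ((A.erase α).erase β).filter (fun k => h' k < 0) =
      ((A.erase α).erase β).filter fun k => h k < 0 := by
    refine Finset.filter_congr fun k hk => ?_
    simp only [Finset.mem_erase] at hk
    have := hpos k hk.2.2
    have := hpos α hα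
    have := hpos β hβ
    rw [hh', Function.comp_apply, Function.comp_apply,
      Equiv.swap_apply_of_ne_of_ne (a := -a) (by omega) (by omega),
      Equiv.swap_apply_of_ne_of_ne (by omega) (by omega)]
  rw [s3] at s2
  have a0 := ne_zero_of_odd hodd hinj ha0
  have b0 := ne_zero_of_odd hodd hinj hb0
  have pα := hpos α hα
  have pβ := hpos β hβ
  have oa := hodd a
  have ob := hodd b
  unfold signedInv
  have key : (A.filter fun k => h k < 0).card ≤ (A.filter fun k => h' k < 0).card ∧
      (¬ Central h a b → (A.filter fun k => h k < 0).card = (A.filter fun k => h' k < 0).card) := by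
    rw [s1, s2]
    unfold Central
    rcases hαa with rfl | rfl <;> rcases hβb with rfl | rfl
    · rw [va, vb]; split_ifs <;> omega
    · rw [va, wb, ob]; split_ifs <;> omega
    · rw [wa, vb, oa]; split_ifs <;> omega
    · rw [wa, wb, oa, ob]; split_ifs <;> omega
  refine ⟨by omega, fun hl => ?_⟩
  have hc := hl.2.1.resolve_left (by omega)
  have := h1.2 hc hl.2.2
  have := key.2 hc
  omega

theorem signedInv_signChange (hodd : ∀ k, h (-k) = -h k) (hinj : Function.Injective h)
    (hpos : ∀ a ∈ A, 0 < a) (ha : a ∈ A) (hf : 0 < h a) (hh' : h' = h ∘ Equiv.swap a (-a)) :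
    signedInv A h < signedInv A h' ∧
      (Linked h A (-a) a → signedInv A h' = signedInv A h + 2) := by
  have a0 := hpos a ha
  have oa := hodd a
  have h1 := invNum_swap (S := signedPoints A) (f := h) (a := -a) (b := a) hinj
    (mem_signedPoints.2 (Or.inr (by simpa using ha))) (mem_signedPoints.2 (Or.inl ha)) (by omega)
    (by omega)
  rw [Equiv.swap_comm, ← hh'] at h1
  have h2 : (A.filter fun k => h' k < 0).card = (A.filter fun k => h k < 0).card + 1 := by
    rw [Finset.card_filter, Finset.card_filter, ← Finset.sum_erase_add _ _ ha,
      ← Finset.sum_erase_add _ _ ha]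
    have e1 : h' a = -h a := by
      rw [hh', Function.comp_apply, Equiv.swap_apply_left, hodd]
    have e2 : ∑ x ∈ A.erase a, (if h' x < 0 then 1 else 0) =
        ∑ x ∈ A.erase a, if h x < 0 then 1 else 0 := by
      refine Finset.sum_congr rfl fun k hk => ?_
      have k0 := hpos k (Finset.mem_of_mem_erase hk)
      rw [hh', Function.comp_apply,
        Equiv.swap_apply_of_ne_of_ne (Finset.ne_of_mem_erase hk) (by omega)]
    rw [e1, e2, if_pos (by omega), if_neg (by omega)]
  unfold signedInv
  refine ⟨by omega, fun hl => ?_⟩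
  have z : ((signedPoints A).filter fun k => (-a < k ∧ k < a) ∧ h (-a) < h k ∧ h k < h a).card
      = 0 := by
    rw [Finset.card_eq_zero, Finset.filter_eq_empty_iff]
    intro k hk hk'
    refine hl.2.2 k (mem_signedPoints.1 hk) ?_
    unfold InBox
    omega
  omega

end Inversions

/-! ### Recognising the length function of a group with generators. -/

section WordLength

variable {W : Type*} [Group W] {S : Set W}

/-- A function which changes by at most `2` under right multiplication by generators, and which
some generator lowers by `2` away from the identity, is twice the length. -/
theorem two_mul_wordLength (L : W → ℕ) (h1 : L 1 = 0) (hup : ∀ w, ∀ s ∈ S, L (w * s) ≤ L w + 2)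
    (hdown : ∀ w, w ≠ 1 → ∃ s ∈ S, L (w * s) + 2 = L w) (hinv : ∀ s ∈ S, s * s = 1) (w : W) :
    2 * wordLength S w = L w := by
  have hword : ∀ k, ∀ w, L w = k → ∃ l : List W, (∀ s ∈ l, s ∈ S) ∧ l.prod = w ∧
      2 * l.length = k := by
    intro k
    induction k using Nat.strong_induction_on with
    | _ k ih =>
    intro w hw
    by_cases hw1 : w = 1
    · exact ⟨[], by simp, by simp [hw1], by simp [← hw, hw1, h1]⟩
    · obtain ⟨s, hs, hsw⟩ := hdown w hw1
      obtain ⟨l, hl, hp, hk⟩ := ih (L (w * s)) (by omega) _ rfl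
      refine ⟨l ++ [s], ?_, ?_, ?_⟩
      · intro t ht
        rcases List.mem_append.1 ht with h | h
        · exact hl t h
        · rwa [List.mem_singleton.1 h]
      · rw [List.prod_append, hp, List.prod_singleton, mul_assoc, hinv s hs, mul_one]
      · simp; omega
  have hle : ∀ l : List W, (∀ s ∈ l, s ∈ S) → L l.prod ≤ 2 * l.length := by
    intro l
    induction l using List.reverseRecOn with
    | nil => simp [h1]
    | append_singleton l s ih =>
      intro hl
      have a := ih fun t ht => hl t (List.mem_append_left _ ht)
      have b := hup l.prod s (hl s (by simp))
      simp only [List.prod_append, List.prod_singleton, List.length_append, List.length_singleton]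
      omega
  obtain ⟨l, hl, hp, hk⟩ := hword _ w rfl
  have hmem : l.length ∈ {k : ℕ | ∃ l : List W, (∀ s ∈ l, s ∈ S) ∧ l.prod = w ∧ l.length = k} :=
    ⟨l, hl, hp, rfl⟩
  have h2 : wordLength S w ≤ l.length := Nat.sInf_le hmem
  obtain ⟨l', hl', hp', hk'⟩ := Nat.sInf_mem ⟨_, hmem⟩
  change l'.length = wordLength S w at hk'
  have h3 := hle l' hl'
  rw [hp'] at h3
  omega

end WordLength

/-! ### Signed permutations as odd functions on the integers, and their length. -/

namespace Hyperoctahedral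

variable {n : ℕ}

theorem apply_neg (π : Hyperoctahedral n) (a : SignedIndex n) : π.1 (-a) = -π.1 a := π.2 a

/-- The signed permutation `π` as a permutation of the integers, fixing all other integers. -/
def toInt (π : Hyperoctahedral n) (k : ℤ) : ℤ :=
  if hk : k ≠ 0 ∧ |k| ≤ (n : ℤ) then (π.1 ⟨k, hk⟩ : ℤ) else k

theorem toInt_coe (π : Hyperoctahedral n) (a : SignedIndex n) : toInt π a = (π.1 a : ℤ) := by
  rw [toInt, dif_pos a.2]

theorem toInt_of_not (π : Hyperoctahedral n) {k : ℤ} (hk : ¬ (k ≠ 0 ∧ |k| ≤ (n : ℤ))) :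
    toInt π k = k := dif_neg hk

theorem toInt_mul (π σ : Hyperoctahedral n) : toInt (π * σ) = toInt π ∘ toInt σ := by
  funext k
  by_cases hk : k ≠ 0 ∧ |k| ≤ (n : ℤ)
  · rw [Function.comp_apply, toInt_coe (π * σ) ⟨k, hk⟩, toInt_coe σ ⟨k, hk⟩, toInt_coe]
    rfl
  · rw [Function.comp_apply, toInt_of_not _ hk, toInt_of_not _ hk, toInt_of_not _ hk]

theorem toInt_one : toInt (1 : Hyperoctahedral n) = id := by
  funext k
  by_cases hk : k ≠ 0 ∧ |k| ≤ (n : ℤ)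
  · rw [toInt_coe 1 ⟨k, hk⟩]; rfl
  · rw [toInt_of_not _ hk]; rfl

theorem toInt_injective (π : Hyperoctahedral n) : Function.Injective (toInt π) := by
  have : toInt π⁻¹ ∘ toInt π = id := by rw [← toInt_mul, inv_mul_cancel, toInt_one]
  exact Function.LeftInverse.injective (g := toInt π⁻¹) fun k => congrFun this k

theorem toInt_neg (π : Hyperoctahedral n) (k : ℤ) : toInt π (-k) = -toInt π k := by
  by_cases hk : k ≠ 0 ∧ |k| ≤ (n : ℤ)
  · have h1 := toInt_coe π ⟨k, hk⟩
    have h2 := toInt_coe π (-⟨k, hk⟩)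
    rw [apply_neg, SignedIndex.coe_neg, SignedIndex.coe_neg, ← h1] at h2
    exact h2
  · rw [toInt_of_not _ hk, toInt_of_not]
    rwa [neg_ne_zero, abs_neg]

theorem swap_coe (a b c : SignedIndex n) :
    ((Equiv.swap a b c : SignedIndex n) : ℤ) = Equiv.swap (a : ℤ) b c := by
  simp only [Equiv.swap_apply_def, Subtype.ext_iff]
  split_ifs <;> rfl

theorem swap_of_not {a b : SignedIndex n} {k : ℤ} (hk : ¬ (k ≠ 0 ∧ |k| ≤ (n : ℤ))) :
    Equiv.swap (a : ℤ) b k = k :=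
  Equiv.swap_apply_of_ne_of_ne (by rintro rfl; exact hk a.2) (by rintro rfl; exact hk b.2)

theorem toInt_signChange (a : SignedIndex n) :
    toInt (signChange a) = Equiv.swap (a : ℤ) (-a : ℤ) := by
  funext k
  by_cases hk : k ≠ 0 ∧ |k| ≤ (n : ℤ)
  · rw [toInt_coe _ ⟨k, hk⟩]
    exact swap_coe a (-a) ⟨k, hk⟩
  · rw [toInt_of_not _ hk]
    exact (swap_of_not (a := a) (b := -a) hk).symm

theorem toInt_signedSwap (a b : SignedIndex n) :
    toInt (signedSwap a b) = Equiv.swap (a : ℤ) (b : ℤ) ∘ Equiv.swap (-a : ℤ) (-b : ℤ) := by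
  funext k
  by_cases hk : k ≠ 0 ∧ |k| ≤ (n : ℤ)
  · rw [toInt_coe _ ⟨k, hk⟩, Function.comp_apply]
    have := swap_coe (-a) (-b) ⟨k, hk⟩
    rw [SignedIndex.coe_neg, SignedIndex.coe_neg] at this
    change _ = Equiv.swap (-a : ℤ) (-b : ℤ) k at this
    rw [← this, ← swap_coe]
    rfl
  · rw [toInt_of_not _ hk, Function.comp_apply,
      show Equiv.swap (-a : ℤ) (-b : ℤ) k = k from swap_of_not (a := -a) (b := -b) hk,
      swap_of_not hk]

/-- The positions `1, …, n`. -/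
noncomputable def positions (n : ℕ) : Finset ℤ := Finset.Icc 1 (n : ℤ)

theorem pos_of_mem_positions : ∀ a ∈ positions n, 0 < a := fun a ha => by
  have := (Finset.mem_Icc.1 ha).1; omega

theorem mem_signedPoints_positions {k : ℤ} :
    k ∈ signedPoints (positions n) ↔ k ≠ 0 ∧ |k| ≤ (n : ℤ) := by
  rw [mem_signedPoints, positions, Finset.mem_Icc, Finset.mem_Icc, abs_le]
  omega

theorem coe_mem_signedPoints (a : SignedIndex n) : (a : ℤ) ∈ signedPoints (positions n) :=
  mem_signedPoints_positions.2 a.2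

/-- Twice the length of `π`. -/
noncomputable def inversions (π : Hyperoctahedral n) : ℕ := signedInv (positions n) (toInt π)

theorem inversions_mul_signedSwap (π : Hyperoctahedral n) {a b : SignedIndex n}
    (hab : (a : ℤ) < b) (hne : (a : ℤ) ≠ -b) (hf : (π.1 a : ℤ) < π.1 b) :
    inversions π < inversions (π * signedSwap a b) ∧
      (Linked (toInt π) (positions n) a b →
        inversions (π * signedSwap a b) = inversions π + 2) := by
  rw [← toInt_coe, ← toInt_coe] at hf
  exact signedInv_signedSwap (toInt_neg π) (toInt_injective π) pos_of_mem_positions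
    (coe_mem_signedPoints a) (coe_mem_signedPoints b) hab hne hf
    (by rw [toInt_mul, toInt_signedSwap])

theorem inversions_mul_signChange (π : Hyperoctahedral n) {a : SignedIndex n}
    (ha : 0 < (a : ℤ)) (hf : 0 < (π.1 a : ℤ)) :
    inversions π < inversions (π * signChange a) ∧
      (Linked (toInt π) (positions n) (-a) a →
        inversions (π * signChange a) = inversions π + 2) := by
  rw [← toInt_coe] at hf
  exact signedInv_signChange (toInt_neg π) (toInt_injective π) pos_of_mem_positions
    (Finset.mem_Icc.2 ⟨by omega, (le_abs_self _).trans a.2.2⟩) hf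
    (by rw [toInt_mul, toInt_signChange])

theorem signChange_mul_self (a : SignedIndex n) : signChange a * signChange a = 1 :=
  Subtype.ext (Equiv.swap_mul_self _ _)

theorem signChange_apply_self (a : SignedIndex n) : (signChange a).1 a = -a :=
  Equiv.swap_apply_left _ _

theorem signChange_apply_of_ne {a c : SignedIndex n} (h1 : c ≠ a) (h2 : c ≠ -a) :
    (signChange a).1 c = c :=
  Equiv.swap_apply_of_ne_of_ne h1 h2

theorem signedSwap_apply (a b c : SignedIndex n) :
    (signedSwap a b).1 c = Equiv.swap a b (Equiv.swap (-a) (-b) c) := rfl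

theorem signedSwap_apply_left {a b : SignedIndex n} (hne : a ≠ -b) : (signedSwap a b).1 a = b := by
  rw [signedSwap_apply, Equiv.swap_apply_of_ne_of_ne (SignedIndex.neg_ne_self a).symm hne,
    Equiv.swap_apply_left]

theorem signedSwap_apply_right {a b : SignedIndex n} (hne : a ≠ -b) :
    (signedSwap a b).1 b = a := by
  rw [signedSwap_apply, Equiv.swap_apply_of_ne_of_ne (a := -a)
    (fun h => hne (by rw [h, neg_neg])) (SignedIndex.neg_ne_self b).symm, Equiv.swap_apply_right]

theorem signedSwap_apply_of_ne {a b c : SignedIndex n} (h1 : c ≠ a) (h2 : c ≠ b) (h3 : c ≠ -a)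
    (h4 : c ≠ -b) : (signedSwap a b).1 c = c := by
  rw [signedSwap_apply, Equiv.swap_apply_of_ne_of_ne h3 h4, Equiv.swap_apply_of_ne_of_ne h1 h2]

theorem ext_apply {π σ : Hyperoctahedral n} (h : ∀ c, π.1 c = σ.1 c) : π = σ :=
  Subtype.ext (Equiv.ext h)

theorem conj_signedSwap (g : Hyperoctahedral n) (a b : SignedIndex n) :
    g * signedSwap a b * g⁻¹ = signedSwap (g.1 a) (g.1 b) := by
  apply Subtype.ext
  change g.1 * (Equiv.swap a b * Equiv.swap (-a) (-b)) * g.1⁻¹ =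
    Equiv.swap (g.1 a) (g.1 b) * Equiv.swap (-(g.1 a)) (-(g.1 b))
  rw [← apply_neg, ← apply_neg, Equiv.swap_apply_apply, Equiv.swap_apply_apply]
  group

theorem conj_signChange (g : Hyperoctahedral n) (a : SignedIndex n) :
    g * signChange a * g⁻¹ = signChange (g.1 a) := by
  apply Subtype.ext
  change g.1 * Equiv.swap a (-a) * g.1⁻¹ = Equiv.swap (g.1 a) (-(g.1 a))
  rw [← apply_neg, Equiv.swap_apply_apply]

theorem signedSwap_mul_self {a b : SignedIndex n} (hne : a ≠ -b) :
    signedSwap a b * signedSwap a b = 1 := by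
  have hc : Commute (Equiv.swap a b) (Equiv.swap (-a) (-b)) := by
    refine Equiv.Perm.Disjoint.commute fun x => ?_
    have hn := SignedIndex.neg_ne_self (n := n)
    by_cases hx : x = a ∨ x = b
    · right
      refine Equiv.swap_apply_of_ne_of_ne ?_ ?_ <;> rcases hx with rfl | rfl
      · exact (hn x).symm
      · exact fun e => hne (by rw [e, neg_neg])
      · exact hne
      · exact (hn x).symm
    · rw [not_or] at hx
      exact Or.inl (Equiv.swap_apply_of_ne_of_ne hx.1 hx.2)
  apply Subtype.ext
  change Equiv.swap a b * Equiv.swap (-a) (-b) * (Equiv.swap a b * Equiv.swap (-a) (-b)) = 1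
  rw [mul_assoc, ← mul_assoc (Equiv.swap (-a) (-b)), ← hc.eq, mul_assoc (Equiv.swap a b),
    Equiv.swap_mul_self, mul_one, Equiv.swap_mul_self]

theorem signedSwap_comm (a b : SignedIndex n) : signedSwap a b = signedSwap b a := by
  apply Subtype.ext
  change Equiv.swap a b * Equiv.swap (-a) (-b) = Equiv.swap b a * Equiv.swap (-b) (-a)
  rw [Equiv.swap_comm b a, Equiv.swap_comm (-b) (-a)]

theorem generator_mul_self {s : Hyperoctahedral n} (hs : s ∈ generators n) : s * s = 1 := by
  rcases hs with ⟨a, ha, rfl⟩ | ⟨a, b, ha, hb, rfl⟩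
  · exact signChange_mul_self a
  · refine signedSwap_mul_self fun h => ?_
    have : (a : ℤ) = -b := by rw [h]; rfl
    omega

theorem apply_ne_of_ne (π : Hyperoctahedral n) {a b : SignedIndex n} (h : (a : ℤ) ≠ b) :
    (π.1 a : ℤ) ≠ π.1 b := fun e => h (by rw [π.1.injective (Subtype.ext e)])

/-- Exchanging the values at two neighbouring positions. -/
theorem inversions_mul_adjacent (π : Hyperoctahedral n) {a b : SignedIndex n} (ha : 0 < (a : ℤ))
    (hb : (b : ℤ) = a + 1) (hf : (π.1 a : ℤ) < π.1 b) :
    inversions (π * signedSwap a b) = inversions π + 2 := by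
  refine (inversions_mul_signedSwap π (by omega) (by omega) hf).2
    ⟨by omega, Or.inr ?_, fun k _ => ?_⟩
  · unfold Central; omega
  · unfold InBox; omega

/-- Changing the sign at the position `1`. -/
theorem inversions_mul_first (π : Hyperoctahedral n) {a : SignedIndex n} (ha : (a : ℤ) = 1)
    (hf : 0 < (π.1 a : ℤ)) : inversions (π * signChange a) = inversions π + 2 := by
  refine (inversions_mul_signChange π (by omega) hf).2 ⟨by omega, Or.inl (by omega), ?_⟩
  intro k hk
  have := (mem_signedPoints_positions.1 (mem_signedPoints.2 hk)).1
  unfold InBox; omega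

theorem inversions_mul_generator (π : Hyperoctahedral n) {s : Hyperoctahedral n}
    (hs : s ∈ generators n) : inversions (π * s) ≤ inversions π + 2 := by
  have hss := generator_mul_self hs
  rcases hs with ⟨a, ha, rfl⟩ | ⟨a, b, ha, hb, rfl⟩
  · rcases lt_or_gt_of_ne (π.1 a).2.1 with h | h
    · have := inversions_mul_first (π * signChange a) ha (by
        change 0 < ((π.1 ((signChange a).1 a) : SignedIndex n) : ℤ)
        rw [signChange_apply_self, apply_neg, SignedIndex.coe_neg]; omega)
      rw [mul_assoc, hss, mul_one] at this
      omega
    · exact (inversions_mul_first π ha h).le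
  · have hne : a ≠ -b := fun h => by
      have : (a : ℤ) = -b := by rw [h]; rfl
      omega
    rcases lt_or_gt_of_ne (apply_ne_of_ne π (a := a) (b := b) (by omega)) with h | h
    · exact (inversions_mul_adjacent π ha hb h).le
    · have := inversions_mul_adjacent (π * signedSwap a b) ha hb (by
        change ((π.1 ((signedSwap a b).1 a) : SignedIndex n) : ℤ) <
          π.1 ((signedSwap a b).1 b)
        rwa [signedSwap_apply_left hne, signedSwap_apply_right hne])
      rw [mul_assoc, hss, mul_one] at this
      omega

/-- If no generator lowers the count, the values at `1, …, n` increase and start positive. Then `π a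
≥ a` by induction from the left and `π a ≤ a` by induction from the right, so `π = 1`. -/
theorem exists_inversions_mul_generator (π : Hyperoctahedral n) (hπ : π ≠ 1) :
    ∃ s ∈ generators n, inversions (π * s) + 2 = inversions π := by
  by_contra hcon
  push Not at hcon
  have hfirst : ∀ a : SignedIndex n, (a : ℤ) = 1 → 0 < (π.1 a : ℤ) := fun a ha => by
    by_contra h
    have hs : signChange a ∈ generators n := Or.inl ⟨a, ha, rfl⟩
    have := inversions_mul_first (π * signChange a) ha (by
      change 0 < ((π.1 ((signChange a).1 a) : SignedIndex n) : ℤ)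
      have := (π.1 a).2.1
      rw [signChange_apply_self, apply_neg, SignedIndex.coe_neg]; omega)
    rw [mul_assoc, generator_mul_self hs, mul_one] at this
    exact hcon _ hs this.symm
  have hstep : ∀ a b : SignedIndex n, 0 < (a : ℤ) → (b : ℤ) = a + 1 →
      (π.1 a : ℤ) < π.1 b := fun a b ha hb => by
    by_contra h
    have h' := apply_ne_of_ne π (a := a) (b := b) (by omega)
    have hne : a ≠ -b := fun h => by
      have : (a : ℤ) = -b := by rw [h]; rfl
      omega
    have hs : signedSwap a b ∈ generators n := Or.inr ⟨a, b, ha, hb, rfl⟩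
    have := inversions_mul_adjacent (π * signedSwap a b) ha hb (by
      change ((π.1 ((signedSwap a b).1 a) : SignedIndex n) : ℤ) < π.1 ((signedSwap a b).1 b)
      rw [signedSwap_apply_left hne, signedSwap_apply_right hne]; omega)
    rw [mul_assoc, generator_mul_self hs, mul_one] at this
    exact hcon _ hs this.symm
  have hlow : ∀ m : ℕ, ∀ a : SignedIndex n, (a : ℤ) = m + 1 → (a : ℤ) ≤ π.1 a := by
    intro m
    induction m with
    | zero => intro a ha; have := hfirst a (by simpa using ha); push_cast at ha; omega
    | succ m ih =>
      intro a ha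
      have ha2 := (le_abs_self _).trans a.2.2
      push_cast at ha
      have hb : ((m : ℤ) + 1) ≠ 0 ∧ |(m : ℤ) + 1| ≤ (n : ℤ) :=
        ⟨by omega, by rw [abs_of_pos (by omega)]; omega⟩
      have h1 := ih ⟨(m : ℤ) + 1, hb⟩ rfl
      have h2 := hstep ⟨(m : ℤ) + 1, hb⟩ a (by simp only; omega) ha
      simp only at h1
      omega
  have hupp : ∀ m : ℕ, ∀ a : SignedIndex n, 0 < (a : ℤ) → (a : ℤ) = n - m →
      (π.1 a : ℤ) ≤ a := by
    intro m
    induction m with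
    | zero =>
      intro a _ ha
      have := (le_abs_self _).trans (π.1 a).2.2
      push_cast at ha
      omega
    | succ m ih =>
      intro a h0 ha
      push_cast at ha
      have hb : ((n : ℤ) - m) ≠ 0 ∧ |(n : ℤ) - m| ≤ (n : ℤ) :=
        ⟨by omega, by rw [abs_of_pos (by omega)]; omega⟩
      have h1 := ih ⟨(n : ℤ) - m, hb⟩ (by simp only; omega) rfl
      have h2 := hstep a ⟨(n : ℤ) - m, hb⟩ h0 (by simp only; omega)
      simp only at h1
      omega
  have hpos : ∀ a : SignedIndex n, 0 < (a : ℤ) → π.1 a = a := fun a ha => by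
    have hn := (le_abs_self _).trans a.2.2
    have h1 := hlow ((a : ℤ) - 1).toNat a (by omega)
    have h2 := hupp ((n : ℤ) - a).toNat a ha (by omega)
    exact Subtype.ext (le_antisymm h2 h1)
  refine hπ (ext_apply fun c => ?_)
  rcases lt_or_gt_of_ne c.2.1 with h | h
  · have := hpos (-c) (by rw [SignedIndex.coe_neg]; omega)
    rw [apply_neg] at this
    exact neg_injective this
  · exact hpos c h

theorem inversions_one : inversions (1 : Hyperoctahedral n) = 0 := by
  rw [inversions, toInt_one, signedInv, invNum, Nat.add_eq_zero_iff, Finset.card_eq_zero,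
    Finset.card_eq_zero, Finset.filter_eq_empty_iff, Finset.filter_eq_empty_iff]
  refine ⟨fun x _ h => ?_, fun x hx h => ?_⟩
  · exact lt_asymm h.1 h.2
  · exact lt_asymm (pos_of_mem_positions x hx) h

theorem two_mul_length (π : Hyperoctahedral n) :
    2 * wordLength (generators n) π = inversions π :=
  two_mul_wordLength inversions inversions_one (fun w _ hs => inversions_mul_generator w hs)
    exists_inversions_mul_generator (fun _ hs => generator_mul_self hs) π

end Hyperoctahedral

/-! ### Bruhat steps, and obstructions to covers. -/

namespace Hyperoctahedral

variable {n : ℕ}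

theorem mul_val_apply (π σ : Hyperoctahedral n) (c : SignedIndex n) :
    (π * σ).1 c = π.1 (σ.1 c) := rfl

theorem exists_apply_eq (c a : SignedIndex n) : ∃ g : Hyperoctahedral n, g.1 c = a := by
  by_cases h : c = -a
  · exact ⟨signChange c, by rw [signChange_apply_self, h, neg_neg]⟩
  · exact ⟨signedSwap c a, signedSwap_apply_left h⟩

theorem signChange_mem_reflections (a : SignedIndex n) :
    signChange a ∈ reflections (generators n) := by
  have ha := a.2
  have h1 : (1 : ℤ) ≠ 0 ∧ |(1 : ℤ)| ≤ (n : ℤ) := by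
    rw [abs_le] at ha
    simp only [abs_one]
    omega
  obtain ⟨g, hg⟩ := exists_apply_eq ⟨1, h1⟩ a
  exact ⟨g, _, Or.inl ⟨⟨1, h1⟩, rfl, rfl⟩, by rw [conj_signChange, hg]⟩

/-- The group acts transitively on ordered pairs of positions that are neither equal nor opposite:
`g` carries 1 to `a`, and `f` fixes 1 and adjusts the image of 2. That 2 is a position follows from
`a ≠ ±b`. -/
theorem signedSwap_mem_reflections {a b : SignedIndex n} (hab : a ≠ b) (hne : a ≠ -b) :
    signedSwap a b ∈ reflections (generators n) := by
  have ha := a.2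
  have hb := b.2
  have hab' : (a : ℤ) ≠ b := fun e => hab (Subtype.ext e)
  have hne' : (a : ℤ) ≠ -b := fun e => hne (Subtype.ext e)
  rw [abs_le] at ha hb
  have h1 : (1 : ℤ) ≠ 0 ∧ |(1 : ℤ)| ≤ (n : ℤ) := by
    simp only [abs_one]
    omega
  have h2 : (2 : ℤ) ≠ 0 ∧ |(2 : ℤ)| ≤ (n : ℤ) := by
    rw [abs_of_pos (by omega)]
    omega
  obtain ⟨g, hg⟩ := exists_apply_eq ⟨1, h1⟩ a
  obtain ⟨b', hb'⟩ := g.1.surjective b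
  have n1 : (⟨1, h1⟩ : SignedIndex n) ≠ ⟨2, h2⟩ := fun e => by simpa using congrArg Subtype.val e
  have n2 : (⟨1, h1⟩ : SignedIndex n) ≠ -⟨2, h2⟩ := fun e => by
    have : (1 : ℤ) = -2 := congrArg Subtype.val e
    omega
  have n3 : ⟨1, h1⟩ ≠ b' := fun e => hab (by rw [← hg, ← hb', e])
  have n4 : ⟨1, h1⟩ ≠ -b' := fun e => hne (by rw [← hg, ← hb', e, apply_neg])
  obtain ⟨f, hf1, hf2⟩ : ∃ f : Hyperoctahedral n, f.1 ⟨1, h1⟩ = ⟨1, h1⟩ ∧ f.1 ⟨2, h2⟩ = b' := by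
    by_cases h : ⟨2, h2⟩ = -b'
    · exact ⟨signChange ⟨2, h2⟩, signChange_apply_of_ne n1 n2, by
        rw [signChange_apply_self, h, neg_neg]⟩
    · exact ⟨signedSwap ⟨2, h2⟩ b', signedSwap_apply_of_ne n1 n3 n2 n4, signedSwap_apply_left h⟩
  refine ⟨g * f, _, Or.inr ⟨⟨1, h1⟩, ⟨2, h2⟩, by simp, by simp, rfl⟩, ?_⟩
  rw [conj_signedSwap, mul_val_apply, mul_val_apply, hf1, hf2, hg, hb']

theorem eq_of_mem_reflections {t : Hyperoctahedral n} (ht : t ∈ reflections (generators n)) :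
    (∃ a, t = signChange a) ∨ ∃ a b, a ≠ b ∧ a ≠ -b ∧ t = signedSwap a b := by
  obtain ⟨w, s, ⟨a, ha, rfl⟩ | ⟨a, b, ha, hb, rfl⟩, rfl⟩ := ht
  · exact Or.inl ⟨_, conj_signChange w a⟩
  · refine Or.inr ⟨_, _, fun e => ?_, fun e => ?_, conj_signedSwap w a b⟩
    · have := congrArg Subtype.val (w.1.injective e)
      omega
    · rw [← apply_neg] at e
      have : (a : ℤ) = -b := congrArg Subtype.val (w.1.injective e)
      omega

/-- Bruhat steps in terms of positions instead of values. -/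
theorem bruhatStep_iff {u v : Hyperoctahedral n} : BruhatStep (generators n) u v ↔
    inversions u < inversions v ∧ ((∃ a, v = u * signChange a) ∨
      ∃ a b, a ≠ b ∧ a ≠ -b ∧ v = u * signedSwap a b) := by
  have hl : ∀ u v : Hyperoctahedral n, wordLength (generators n) u < wordLength (generators n) v ↔
      inversions u < inversions v := fun u v => by
    rw [← two_mul_length, ← two_mul_length]; omega
  constructor
  · rintro ⟨t, ht, rfl, hlt⟩
    refine ⟨(hl _ _).1 hlt, ?_⟩
    rcases eq_of_mem_reflections ht with ⟨a, rfl⟩ | ⟨a, b, h1, h2, rfl⟩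
    -- With `u = t * v`, the element `v⁻¹ * t⁻¹` is `u⁻¹`, and `v = u * (u⁻¹ * t * u)`: a reflection
    -- on the left is turned into one on the right by conjugation.
    · refine Or.inl ⟨(v⁻¹ * (signChange a)⁻¹).1 a, ?_⟩
      rw [← conj_signChange]
      simp only [mul_assoc, mul_inv_rev, inv_inv, inv_mul_cancel, mul_one, mul_inv_cancel_left]
      rw [← mul_assoc, signChange_mul_self, one_mul]
    · refine Or.inr ⟨(v⁻¹ * (signedSwap a b)⁻¹).1 a, (v⁻¹ * (signedSwap a b)⁻¹).1 b,
        fun e => h1 (Equiv.injective _ e), fun e => h2 ?_, ?_⟩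
      · rw [← apply_neg] at e
        exact Equiv.injective _ e
      · rw [← conj_signedSwap]
        simp only [mul_assoc, mul_inv_rev, inv_inv, inv_mul_cancel, mul_one, mul_inv_cancel_left]
        rw [← mul_assoc, signedSwap_mul_self h2, one_mul]
  · rintro ⟨hlt, ⟨a, rfl⟩ | ⟨a, b, h1, h2, rfl⟩⟩
    · refine ⟨signChange (u.1 a), signChange_mem_reflections _, ?_, (hl _ _).2 hlt⟩
      rw [← conj_signChange]
      simp [mul_assoc, signChange_mul_self]
    · refine ⟨signedSwap (u.1 a) (u.1 b), signedSwap_mem_reflections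
        (fun e => h1 (u.1.injective e)) (fun e => h2 ?_), ?_, (hl _ _).2 hlt⟩
      · rw [← apply_neg] at e
        exact u.1.injective e
      · rw [← conj_signedSwap]
        simp [mul_assoc, signedSwap_mul_self h2]

theorem lt_of_bruhatStep {u v : Hyperoctahedral n} (h : BruhatStep (generators n) u v) : u < v := by
  refine lt_of_le_of_ne (Relation.ReflTransGen.single h) ?_
  rintro rfl
  exact lt_irrefl _ (bruhatStep_iff.1 h).1

theorem inversions_lt_of_lt {u v : Hyperoctahedral n} (h : u < v) :
    inversions u < inversions v := by
  rcases BruhatLE.eq_or_length_lt (S := generators n) (u := u) (v := v) h.le with e | hlt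
  · exact absurd e h.ne
  · rw [← two_mul_length, ← two_mul_length]; omega

theorem bruhatStep_of_covBy {u v : Hyperoctahedral n} (h : u ⋖ v) :
    BruhatStep (generators n) u v := by
  have hle : Relation.ReflTransGen (BruhatStep (generators n)) u v := h.lt.le
  rcases Relation.ReflTransGen.cases_head hle with e | ⟨w, huw, hwv⟩
  · exact absurd e h.lt.ne
  · have hwv' : w ≤ v := hwv
    rcases hwv'.eq_or_lt with rfl | hlt
    · exact huw
    · exact absurd hlt (h.2 (lt_of_bruhatStep huw))

/-- The count is twice the length, hence even, so no value attained lies strictly between. -/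
theorem covBy_of_inversions {u v : Hyperoctahedral n} (h : BruhatStep (generators n) u v)
    (hi : inversions v = inversions u + 2) : u ⋖ v := by
  refine ⟨lt_of_bruhatStep h, fun w h1 h2 => ?_⟩
  have a := inversions_lt_of_lt h1
  have b := inversions_lt_of_lt h2
  rw [← two_mul_length u, ← two_mul_length w] at a
  rw [← two_mul_length v, ← two_mul_length w] at b
  rw [← two_mul_length v, ← two_mul_length u] at hi
  omega

theorem not_covBy_of_steps {u w w' v : Hyperoctahedral n} (h1 : BruhatStep (generators n) u w)
    (h2 : BruhatStep (generators n) w w') (h3 : BruhatStep (generators n) w' v) : ¬ u ⋖ v :=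
  fun h => h.2 (lt_of_bruhatStep h1) ((lt_of_bruhatStep h2).trans (lt_of_bruhatStep h3))

theorem bruhatStep_signedSwap (π : Hyperoctahedral n) {a b : SignedIndex n} (hab : (a : ℤ) < b)
    (hne : a ≠ -b) (hf : (π.1 a : ℤ) < π.1 b) :
    BruhatStep (generators n) π (π * signedSwap a b) :=
  bruhatStep_iff.2 ⟨(inversions_mul_signedSwap π hab (fun e => hne (Subtype.ext e)) hf).1,
    Or.inr ⟨a, b, fun e => hab.ne (by rw [e]), hne, rfl⟩⟩

theorem bruhatStep_signChange (π : Hyperoctahedral n) {a : SignedIndex n} (ha : 0 < (a : ℤ))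
    (hf : 0 < (π.1 a : ℤ)) : BruhatStep (generators n) π (π * signChange a) :=
  bruhatStep_iff.2 ⟨(inversions_mul_signChange π ha hf).1, Or.inl ⟨a, rfl⟩⟩

theorem signedSwap_neg_neg {a b : SignedIndex n} (hne : a ≠ -b) :
    signedSwap (-a) (-b) = signedSwap a b := by
  rw [← inv_eq_of_mul_eq_one_right (signedSwap_mul_self hne)]
  apply Subtype.ext
  change Equiv.swap (-a) (-b) * Equiv.swap (- -a) (- -b) =
    (Equiv.swap a b * Equiv.swap (-a) (-b))⁻¹
  rw [neg_neg, neg_neg, mul_inv_rev, Equiv.swap_inv, Equiv.swap_inv]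

theorem signedSwap_mul_signedSwap {i j k : SignedIndex n} (hik : i ≠ -k) (hji : j ≠ i) (hji' : j ≠ -i)
    (hjk : j ≠ k) (hjk' : j ≠ -k) :
    signedSwap i k * signedSwap i j = signedSwap k j * signedSwap i k := by
  have h := conj_signedSwap (signedSwap i k) i j
  rw [signedSwap_apply_left hik, signedSwap_apply_of_ne hji hjk hji' hjk', mul_inv_eq_iff_eq_mul] at h
  exact h

theorem signedSwap_mul_signChange {a b : SignedIndex n} (hab : a ≠ -b) :
    signedSwap a b * signChange a = signChange b * signedSwap a b := by
  have h := conj_signChange (signedSwap a b) a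
  rwa [signedSwap_apply_left hab, mul_inv_eq_iff_eq_mul] at h

theorem signChange_conj_signedSwap {a b : SignedIndex n} (h1 : b ≠ a) (h2 : b ≠ -a) :
    signChange a * signedSwap a b * signChange a = signedSwap (-a) b := by
  have h := conj_signedSwap (signChange a) a b
  rwa [signChange_apply_self, signChange_apply_of_ne h1 h2,
    inv_eq_of_mul_eq_one_right (signChange_mul_self a)] at h

theorem signChange_comm {a b : SignedIndex n} (h1 : b ≠ a) (h2 : b ≠ -a) :
    signChange a * signChange b = signChange b * signChange a := by
  have h := conj_signChange (signChange a) b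
  rwa [signChange_apply_of_ne h1 h2, mul_inv_eq_iff_eq_mul] at h

/-- A box with a point strictly inside does not give a cover. -/
theorem not_covBy_of_between (π : Hyperoctahedral n) {i j k : SignedIndex n} (hik : (i : ℤ) < k)
    (hkj : (k : ℤ) < j) (hv : (π.1 i : ℤ) < π.1 k) (hv' : (π.1 k : ℤ) < π.1 j)
    (n1 : i ≠ -k) (n2 : j ≠ -k) (n3 : j ≠ -i) : ¬ π ⋖ π * signedSwap i j := by
  have d1 : j ≠ i := fun e => by rw [e] at hkj; omega
  have d2 : j ≠ k := fun e => by rw [e] at hkj; omega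
  have d3 : k ≠ i := fun e => by rw [e] at hik; omega
  have n1' : k ≠ -i := fun e => n1 (by rw [e, neg_neg])
  have n2' : k ≠ -j := fun e => n2 (by rw [e, neg_neg])
  have n3' : i ≠ -j := fun e => n3 (by rw [e, neg_neg])
  have s1 := bruhatStep_signedSwap π hik n1 hv
  have s2 := bruhatStep_signedSwap (π * signedSwap i k) (a := i) (b := j) (by omega) n3' (by
    rw [mul_val_apply, mul_val_apply, signedSwap_apply_left n1, signedSwap_apply_of_ne d1 d2 n3 n2]
    exact hv')
  have s3 := bruhatStep_signedSwap (π * signedSwap i k * signedSwap i j) (a := k) (b := j) hkj n2'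
    (by
      rw [mul_val_apply, mul_val_apply, mul_val_apply, mul_val_apply,
        signedSwap_apply_of_ne d3 d2.symm n1' n2', signedSwap_apply_right n1,
        signedSwap_apply_right n3', signedSwap_apply_left n1]
      exact hv)
  -- The exchange of `i` and `j` factors through the intermediate point as `(i k)(i j)(k j)`, and
  -- each factor increases the length.
  have e : π * signedSwap i k * signedSwap i j * signedSwap k j = π * signedSwap i j := by
    rw [mul_assoc, mul_assoc, ← mul_assoc (signedSwap i k),
      signedSwap_mul_signedSwap n1 d1 n3 d2 n2, mul_assoc]
    have h := conj_signedSwap (signedSwap k j) i k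
    rw [signedSwap_apply_left n2', signedSwap_apply_of_ne d3.symm d1.symm n1 n3',
      inv_eq_of_mul_eq_one_right (signedSwap_mul_self n2'), mul_assoc] at h
    rw [h]
  rw [← e]
  exact not_covBy_of_steps s1 s2 s3

/-- A box which contains the origin and is not symmetric does not give a cover. -/
theorem not_covBy_of_central (π : Hyperoctahedral n) {a b : SignedIndex n} (ha : 0 < (a : ℤ))
    (hab : (a : ℤ) < b) (hva : 0 < (π.1 a : ℤ)) (hvb : 0 < (π.1 b : ℤ)) :
    ¬ π ⋖ π * signedSwap (-a) b := by
  have d1 : b ≠ a := fun e => by rw [e] at hab; omega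
  have d2 : b ≠ -a := fun e => by
    have : (b : ℤ) = -a := by rw [e]; rfl
    omega
  have d3 : a ≠ -b := fun e => d2 (by rw [e, neg_neg])
  -- The reflection is a product of the exchange of `a` and `b` and both sign changes. The exchange
  -- comes before the sign changes when `π a < π b` and after them otherwise, so that every step
  -- goes up.
  rcases lt_or_gt_of_ne (apply_ne_of_ne π hab.ne) with h | h
  · have s1 := bruhatStep_signedSwap π hab d3 h
    have s2 := bruhatStep_signChange (π * signedSwap a b) ha (by
      rwa [mul_val_apply, signedSwap_apply_left d3])
    have s3 := bruhatStep_signChange (π * signedSwap a b * signChange a) (a := b) (by omega) (by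
      rwa [mul_val_apply, mul_val_apply, signChange_apply_of_ne d1 d2, signedSwap_apply_right d3])
    have e : π * signedSwap a b * signChange a * signChange b = π * signedSwap (-a) b := by
      rw [← signChange_conj_signedSwap d1 d2, mul_assoc, mul_assoc, signChange_comm d1 d2,
        ← mul_assoc (signedSwap a b), signedSwap_comm a b,
        signedSwap_mul_signChange (fun e => d2 e)]
    rw [← e]
    exact not_covBy_of_steps s1 s2 s3
  · have s1 := bruhatStep_signChange π ha hva
    have s2 := bruhatStep_signChange (π * signChange a) (a := b) (by omega) (by
      rwa [mul_val_apply, signChange_apply_of_ne d1 d2])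
    have s3 := bruhatStep_signedSwap (π * signChange a * signChange b) (a := a) (b := b) hab d3 (by
      rw [mul_val_apply, mul_val_apply, mul_val_apply, mul_val_apply, signChange_apply_self,
        signChange_apply_of_ne d1.symm d3, signChange_apply_self, apply_neg, apply_neg,
        signChange_apply_of_ne d1 d2, apply_neg, SignedIndex.coe_neg, SignedIndex.coe_neg]
      omega)
    have e : π * signChange a * signChange b * signedSwap a b = π * signedSwap (-a) b := by
      rw [← signChange_conj_signedSwap d1 d2, mul_assoc, mul_assoc,
        ← signedSwap_mul_signChange d3, mul_assoc]
    rw [← e]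
    exact not_covBy_of_steps s1 s2 s3

/-- A symmetric box with a point strictly inside does not give a cover. -/
theorem not_covBy_of_symmetric (π : Hyperoctahedral n) {k j : SignedIndex n} (hk : 0 < (k : ℤ))
    (hkj : (k : ℤ) < j) (hv : |(π.1 k : ℤ)| < π.1 j) : ¬ π ⋖ π * signChange j := by
  have d1 : j ≠ k := fun e => by rw [e] at hkj; omega
  have d2 : j ≠ -k := fun e => by
    have : (j : ℤ) = -k := by rw [e]; rfl
    omega
  have d3 : k ≠ -j := fun e => d2 (by rw [e, neg_neg])
  have d4 : -k ≠ -j := fun e => d1 (neg_injective e).symm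
  rw [abs_lt] at hv
  have s1 := bruhatStep_signedSwap π hkj d3 hv.2
  have e0 : signedSwap k j * signedSwap (-k) j = signChange j * signChange k := by
    rw [← signChange_conj_signedSwap d1 d2, ← mul_assoc, ← mul_assoc,
      signedSwap_mul_signChange d3, mul_assoc (signChange j), signedSwap_mul_self d3, mul_one]
  rcases lt_or_gt_of_ne (π.1 k).2.1 with h | h
  · have s2 := bruhatStep_signedSwap (π * signedSwap k j) (a := -k) (b := j)
      (by rw [SignedIndex.coe_neg]; omega) d4 (by
        rw [apply_neg, mul_val_apply, mul_val_apply, signedSwap_apply_left d3,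
          signedSwap_apply_right d3, SignedIndex.coe_neg]
        omega)
    have s3 := bruhatStep_signChange (π * signedSwap k j * signedSwap (-k) j) hk (by
      rw [mul_val_apply, mul_val_apply, ← neg_neg k, apply_neg, neg_neg, signedSwap_apply_left d4,
        apply_neg, signedSwap_apply_right d3, apply_neg, SignedIndex.coe_neg]
      omega)
    have e : π * signedSwap k j * signedSwap (-k) j * signChange k = π * signChange j := by
      rw [mul_assoc π, e0, mul_assoc, mul_assoc, signChange_mul_self, mul_one]
    rw [← e]
    exact not_covBy_of_steps s1 s2 s3
  · have s2 := bruhatStep_signChange (π * signedSwap k j) (a := j) (by omega) (by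
      rwa [mul_val_apply, signedSwap_apply_right d3])
    have s3 := bruhatStep_signedSwap (π * signedSwap k j * signChange j) (a := -k) (b := j)
      (by rw [SignedIndex.coe_neg]; omega) d4 (by
        rw [apply_neg, mul_val_apply, mul_val_apply, mul_val_apply, mul_val_apply,
          signChange_apply_of_ne d1.symm d3, signChange_apply_self, signedSwap_apply_left d3,
          apply_neg, apply_neg, signedSwap_apply_right d3, SignedIndex.coe_neg, SignedIndex.coe_neg]
        omega)
    have e : π * signedSwap k j * signChange j * signedSwap (-k) j = π * signChange j := by
      have h1 := signedSwap_mul_signChange (a := j) (b := k) d2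
      rw [signedSwap_comm j k] at h1
      rw [mul_assoc π, h1, mul_assoc, mul_assoc (signChange k), e0, signChange_comm d1.symm d3,
        ← mul_assoc, ← mul_assoc, mul_assoc π, signChange_mul_self, mul_one]
    rw [← e]
    exact not_covBy_of_steps s1 s2 s3

end Hyperoctahedral

/-! ### The correspondence between Hasse diagram edges and linked pairs. -/

section LinkedExchange

variable {h h' : ℤ → ℤ} {A : Finset ℤ} {i j : ℤ}

/-- Exchanging the values at `±i` and `±j` keeps `i` and `j` linked. -/
theorem Linked.exchange (hodd : ∀ k, h (-k) = -h k) (hi : h' i = h j) (hj : h' j = h i)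
    (hk : ∀ k, k ≠ i → k ≠ j → k ≠ -i → k ≠ -j → h' k = h k) (hodd' : ∀ k, h' (-k) = -h' k)
    (hl : Linked h A i j) : Linked h' A i j := by
  obtain ⟨h1, h2, h3⟩ := hl
  refine ⟨h1, ?_, fun k hkA hb => ?_⟩
  · rcases h2 with h2 | h2
    · exact Or.inl h2
    · right; unfold Central at *; omega
  -- Only the heights over `±i` and `±j` change. A point over `-i` or `-j` inside the new box would
  -- force the box to contain the origin, which is excluded.
  · have h4 := h3 k hkA
    have hoi := hodd i
    have hoj := hodd j
    have hoi' := hodd' i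
    have hoj' := hodd' j
    unfold InBox Central at *
    by_cases k1 : k = i
    · omega
    by_cases k2 : k = j
    · omega
    by_cases k3 : k = -i
    · subst k3; omega
    by_cases k4 : k = -j
    · subst k4; omega
    rw [hk k k1 k2 k3 k4] at hb
    omega

end LinkedExchange

namespace Hyperoctahedral

variable {n : ℕ}

theorem linked_of_covBy_signedSwap (π : Hyperoctahedral n) {a b : SignedIndex n}
    (hab : (a : ℤ) < b) (hne : a ≠ -b) (hf : (π.1 a : ℤ) < π.1 b)
    (hc : π ⋖ π * signedSwap a b) : Linked (toInt π) (positions n) a b := by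
  have hne' : (a : ℤ) ≠ -b := fun e => hne (Subtype.ext e)
  have hcen : ¬ Central (toInt π) a b := by
    unfold Central
    rw [toInt_coe, toInt_coe]
    intro hC
    have hva : 0 < (π.1 (-a) : ℤ) := by rw [apply_neg, SignedIndex.coe_neg]; omega
    rcases lt_or_gt_of_ne hne' with h | h
    · refine not_covBy_of_central π (a := b) (b := -a) (by omega)
        (by rw [SignedIndex.coe_neg]; omega) (by omega) hva ?_
      rwa [signedSwap_neg_neg (fun e => hne (by rw [e, neg_neg])), signedSwap_comm]
    · refine not_covBy_of_central π (a := -a) (b := b) (by rw [SignedIndex.coe_neg]; omega)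
        (by rw [SignedIndex.coe_neg]; omega) hva (by omega) ?_
      rwa [neg_neg]
  refine ⟨hab.ne, Or.inr hcen, fun k hk hb => ?_⟩
  obtain ⟨k, rfl⟩ : ∃ k' : SignedIndex n, (k' : ℤ) = k :=
    ⟨⟨k, mem_signedPoints_positions.1 (mem_signedPoints.2 hk)⟩, rfl⟩
  unfold InBox at hb
  unfold Central at hcen
  simp only [toInt_coe] at hb hcen
  refine not_covBy_of_between π (k := k) (by omega) (by omega) (by omega) (by omega) ?_ ?_
    (fun e => hne (by rw [e, neg_neg])) hc
  · rintro rfl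
    rw [apply_neg, SignedIndex.coe_neg, SignedIndex.coe_neg] at *
    omega
  · rintro rfl
    rw [apply_neg, SignedIndex.coe_neg, SignedIndex.coe_neg] at *
    omega

theorem linked_of_covBy_signChange (π : Hyperoctahedral n) {a : SignedIndex n} (ha : 0 < (a : ℤ))
    (hf : 0 < (π.1 a : ℤ)) (hc : π ⋖ π * signChange a) :
    Linked (toInt π) (positions n) (-a) a := by
  refine ⟨by omega, Or.inl (by omega), fun k hk hb => ?_⟩
  obtain ⟨k, rfl⟩ : ∃ k' : SignedIndex n, (k' : ℤ) = k :=
    ⟨⟨k, mem_signedPoints_positions.1 (mem_signedPoints.2 hk)⟩, rfl⟩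
  unfold InBox at hb
  simp only [toInt_neg, toInt_coe] at hb
  rcases lt_or_gt_of_ne k.2.1 with h | h
  · refine not_covBy_of_symmetric π (k := -k) (j := a) (by rw [SignedIndex.coe_neg]; omega)
      (by rw [SignedIndex.coe_neg]; omega) ?_ hc
    rw [apply_neg, SignedIndex.coe_neg, abs_neg, abs_lt]
    omega
  · exact not_covBy_of_symmetric π h (by omega) (abs_lt.2 (by omega)) hc

/-- The reflection which moves the position `i` to the position `j`. -/
noncomputable def pairReflection (i j : SignedIndex n) : Hyperoctahedral n :=
  open Classical in if i = -j then signChange j else signedSwap i j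

theorem pairReflection_of_eq {i j : SignedIndex n} (h : i = -j) :
    pairReflection i j = signChange j := if_pos h

theorem pairReflection_of_ne {i j : SignedIndex n} (h : i ≠ -j) :
    pairReflection i j = signedSwap i j := if_neg h

theorem pairReflection_mul_self (i j : SignedIndex n) :
    pairReflection i j * pairReflection i j = 1 := by
  by_cases h : i = -j
  · rw [pairReflection_of_eq h, signChange_mul_self]
  · rw [pairReflection_of_ne h, signedSwap_mul_self h]

theorem pairReflection_apply_right (i j : SignedIndex n) : (pairReflection i j).1 j = i := by
  by_cases h : i = -j
  · rw [pairReflection_of_eq h, signChange_apply_self, h]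
  · rw [pairReflection_of_ne h, signedSwap_apply_right h]

theorem pairReflection_apply_left (i j : SignedIndex n) : (pairReflection i j).1 i = j := by
  by_cases h : i = -j
  · rw [pairReflection_of_eq h, h, apply_neg, signChange_apply_self, neg_neg]
  · rw [pairReflection_of_ne h, signedSwap_apply_left h]

theorem pairReflection_apply_of_ne {i j k : SignedIndex n} (h1 : k ≠ i) (h2 : k ≠ j)
    (h3 : k ≠ -i) (h4 : k ≠ -j) : (pairReflection i j).1 k = k := by
  by_cases h : i = -j
  · rw [pairReflection_of_eq h, signChange_apply_of_ne h2 h4]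
  · rw [pairReflection_of_ne h, signedSwap_apply_of_ne h1 h2 h3 h4]

theorem exists_eq_pairReflection {t : Hyperoctahedral n}
    (ht : (∃ a, t = signChange a) ∨ ∃ a b, a ≠ b ∧ a ≠ -b ∧ t = signedSwap a b) :
    ∃ i j : SignedIndex n, (i : ℤ) < j ∧ 0 ≤ (i : ℤ) + j ∧ t = pairReflection i j := by
  rcases ht with ⟨a, rfl⟩ | ⟨a, b, h1, h2, rfl⟩
  · rcases lt_or_gt_of_ne a.2.1 with h | h
    · refine ⟨a, -a, by rw [SignedIndex.coe_neg]; omega, by rw [SignedIndex.coe_neg]; omega, ?_⟩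
      rw [pairReflection_of_eq (neg_neg a).symm]
      apply Subtype.ext
      change Equiv.swap a (-a) = Equiv.swap (-a) (- -a)
      rw [neg_neg, Equiv.swap_comm]
    · refine ⟨-a, a, by rw [SignedIndex.coe_neg]; omega, by rw [SignedIndex.coe_neg]; omega, ?_⟩
      rw [pairReflection_of_eq rfl]
  · have key : ∀ a b : SignedIndex n, (a : ℤ) < b → a ≠ -b → ∃ i j : SignedIndex n,
        (i : ℤ) < j ∧ 0 ≤ (i : ℤ) + j ∧ signedSwap a b = pairReflection i j := by
      intro a b hab hne
      rcases le_or_gt 0 ((a : ℤ) + b) with h | h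
      · exact ⟨a, b, hab, h, (pairReflection_of_ne hne).symm⟩
      · refine ⟨-b, -a, by simp only [SignedIndex.coe_neg]; omega,
          by simp only [SignedIndex.coe_neg]; omega, ?_⟩
        rw [pairReflection_of_ne (fun e => hne (by rw [e, neg_neg])), signedSwap_comm (-b),
          signedSwap_neg_neg hne]
    rcases lt_or_gt_of_ne (fun e => h1 (Subtype.ext e) : (a : ℤ) ≠ b) with h | h
    · exact key a b h h2
    · rw [signedSwap_comm]
      exact key b a h (fun e => h2 (by rw [e, neg_neg]))

theorem bruhatStep_pairReflection (π : Hyperoctahedral n) {i j : SignedIndex n}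
    (hij : (i : ℤ) < j) (hf : (π.1 i : ℤ) < π.1 j) :
    BruhatStep (generators n) π (π * pairReflection i j) := by
  by_cases h : i = -j
  · subst h
    rw [apply_neg, SignedIndex.coe_neg] at hf
    rw [SignedIndex.coe_neg] at hij
    rw [pairReflection_of_eq rfl]
    exact bruhatStep_signChange π (by omega) (by omega)
  · rw [pairReflection_of_ne h]
    exact bruhatStep_signedSwap π hij h hf

theorem covBy_mul_pairReflection_iff (π : Hyperoctahedral n) {i j : SignedIndex n}
    (hij : (i : ℤ) < j) (hf : (π.1 i : ℤ) < π.1 j) :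
    π ⋖ π * pairReflection i j ↔ Linked (toInt π) (positions n) i j := by
  have hs := bruhatStep_pairReflection π hij hf
  by_cases h : i = -j
  · subst h
    rw [apply_neg, SignedIndex.coe_neg] at hf
    rw [SignedIndex.coe_neg] at hij
    rw [pairReflection_of_eq rfl] at hs ⊢
    exact ⟨linked_of_covBy_signChange π (by omega) (by omega), fun hl =>
      covBy_of_inversions hs ((inversions_mul_signChange π (by omega) (by omega)).2 hl)⟩
  · rw [pairReflection_of_ne h] at hs ⊢
    exact ⟨linked_of_covBy_signedSwap π hij h hf, fun hl => covBy_of_inversions hs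
      ((inversions_mul_signedSwap π hij (fun e => h (Subtype.ext e)) hf).2 hl)⟩

theorem linked_mul_pairReflection (π : Hyperoctahedral n) {i j : SignedIndex n}
    (hl : Linked (toInt π) (positions n) i j) :
    Linked (toInt (π * pairReflection i j)) (positions n) i j := by
  refine hl.exchange (toInt_neg π) ?_ ?_ (fun k h1 h2 h3 h4 => ?_) (toInt_neg _)
  · rw [toInt_coe, mul_val_apply, pairReflection_apply_left, toInt_coe]
  · rw [toInt_coe, mul_val_apply, pairReflection_apply_right, toInt_coe]
  · by_cases hk : k ≠ 0 ∧ |k| ≤ (n : ℤ)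
    · obtain ⟨k, rfl⟩ : ∃ k' : SignedIndex n, (k' : ℤ) = k := ⟨⟨k, hk⟩, rfl⟩
      rw [toInt_coe, toInt_coe, mul_val_apply, pairReflection_apply_of_ne]
      · exact fun e => h1 (by rw [e])
      · exact fun e => h2 (by rw [e])
      · exact fun e => h3 (by rw [e, SignedIndex.coe_neg])
      · exact fun e => h4 (by rw [e, SignedIndex.coe_neg])
    · rw [toInt_of_not _ hk, toInt_of_not _ hk]

theorem mul_pairReflection_cancel (π : Hyperoctahedral n) (i j : SignedIndex n) :
    π * pairReflection i j * pairReflection i j = π := by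
  rw [mul_assoc, pairReflection_mul_self, mul_one]

/-- The neighbours of `π` in the Hasse diagram correspond to the linked pairs of positions. -/
theorem adj_mul_pairReflection_iff (π : Hyperoctahedral n) {i j : SignedIndex n}
    (hij : (i : ℤ) < j) : (hasseDiagram n).Adj π (π * pairReflection i j) ↔
      Linked (toInt π) (positions n) i j := by
  rw [SimpleGraph.hasse_adj]
  have e1 : (π * pairReflection i j).1 i = π.1 j := by
    rw [mul_val_apply, pairReflection_apply_left]
  have e2 : (π * pairReflection i j).1 j = π.1 i := by
    rw [mul_val_apply, pairReflection_apply_right]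
  rcases lt_or_gt_of_ne (apply_ne_of_ne π hij.ne) with hf | hf
  · have h1 := lt_of_bruhatStep (bruhatStep_pairReflection π hij hf)
    rw [← covBy_mul_pairReflection_iff π hij hf]
    exact or_iff_left fun h2 => lt_asymm h1 h2.lt
  · have hf' : ((π * pairReflection i j).1 i : ℤ) < (π * pairReflection i j).1 j := by
      rwa [e1, e2]
    have h1 := lt_of_bruhatStep (bruhatStep_pairReflection (π * pairReflection i j) hij hf')
    have h2 := covBy_mul_pairReflection_iff (π * pairReflection i j) hij hf'
    rw [mul_pairReflection_cancel] at h1 h2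
    rw [or_iff_right fun h3 => lt_asymm h1 h3.lt, h2]
    refine ⟨fun hl => ?_, linked_mul_pairReflection π⟩
    have := linked_mul_pairReflection _ hl
    rwa [mul_pairReflection_cancel] at this

theorem exists_of_adj {π v : Hyperoctahedral n} (h : (hasseDiagram n).Adj π v) :
    ∃ i j : SignedIndex n, (i : ℤ) < j ∧ 0 ≤ (i : ℤ) + j ∧ v = π * pairReflection i j := by
  have key : ∀ u v : Hyperoctahedral n, u ⋖ v →
      ∃ i j : SignedIndex n, (i : ℤ) < j ∧ 0 ≤ (i : ℤ) + j ∧ v = u * pairReflection i j := by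
    intro u v huv
    have ht : (∃ a, u⁻¹ * v = signChange a) ∨
        ∃ a b, a ≠ b ∧ a ≠ -b ∧ u⁻¹ * v = signedSwap a b := by
      rcases (bruhatStep_iff.1 (bruhatStep_of_covBy huv)).2 with ⟨a, rfl⟩ | ⟨a, b, h1, h2, rfl⟩
      · exact Or.inl ⟨a, by rw [inv_mul_cancel_left]⟩
      · exact Or.inr ⟨a, b, h1, h2, by rw [inv_mul_cancel_left]⟩
    obtain ⟨i, j, h1, h2, h3⟩ := exists_eq_pairReflection ht
    exact ⟨i, j, h1, h2, by rw [← h3, mul_inv_cancel_left]⟩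
  rcases SimpleGraph.hasse_adj.1 h with h | h
  · exact key π v h
  · obtain ⟨i, j, h1, h2, h3⟩ := key v π h
    exact ⟨i, j, h1, h2, by rw [h3, mul_pairReflection_cancel]⟩

/-- With the normalisation `i < j` and `0 ≤ i + j`, the position `j` is the largest one moved, so
the reflection determines `j` and then its image `i`. -/
theorem pairReflection_injective {i j i' j' : SignedIndex n} (h1 : (i : ℤ) < j)
    (h2 : 0 ≤ (i : ℤ) + j) (h1' : (i' : ℤ) < j') (h2' : 0 ≤ (i' : ℤ) + j')
    (h : pairReflection i j = pairReflection i' j') : i = i' ∧ j = j' := by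
  have key : ∀ i j i' j' : SignedIndex n, (i : ℤ) < j → 0 ≤ (i : ℤ) + j → (i' : ℤ) < j' →
      pairReflection i j = pairReflection i' j' → ¬ (j : ℤ) < j' := by
    intro i j i' j' h1 h2 h1' h hlt
    have e := pairReflection_apply_right i' j'
    rw [← h, pairReflection_apply_of_ne] at e
    · rw [e] at h1'; omega
    · rintro rfl; omega
    · rintro rfl; omega
    · rintro rfl; rw [SignedIndex.coe_neg] at hlt; omega
    · rintro rfl; rw [SignedIndex.coe_neg] at hlt; omega
  have hj : j = j' := Subtype.ext
    (le_antisymm (not_lt.1 (key i' j' i j h1' h2' h1 h.symm)) (not_lt.1 (key i j i' j' h1 h2 h1' h)))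
  subst hj
  refine ⟨?_, rfl⟩
  rw [← pairReflection_apply_right i j, h, pairReflection_apply_right]

theorem degree_eq_card_linkPairs [DecidableRel (hasseDiagram n).Adj] (π : Hyperoctahedral n) :
    (hasseDiagram n).degree π = (linkPairs (toInt π) (positions n)).card := by
  symm
  have hmem : ∀ x ∈ linkPairs (toInt π) (positions n),
      (x.1 ≠ 0 ∧ |x.1| ≤ (n : ℤ)) ∧ (x.2 ≠ 0 ∧ |x.2| ≤ (n : ℤ)) := fun x hx =>
    ⟨mem_signedPoints_positions.1 (mem_linkPairs.1 hx).1,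
      mem_signedPoints_positions.1 (mem_linkPairs.1 hx).2.1⟩
  refine Finset.card_bij (fun x hx => π * pairReflection ⟨x.1, (hmem x hx).1⟩
    ⟨x.2, (hmem x hx).2⟩) (fun x hx => ?_) (fun x hx y hy e => ?_) (fun v hv => ?_)
  · rw [SimpleGraph.mem_neighborFinset]
    exact (adj_mul_pairReflection_iff π (mem_linkPairs.1 hx).2.2.1).2 (mem_linkPairs.1 hx).2.2.2.2
  · obtain ⟨h1, h2⟩ := pairReflection_injective (mem_linkPairs.1 hx).2.2.1
      (mem_linkPairs.1 hx).2.2.2.1 (mem_linkPairs.1 hy).2.2.1 (mem_linkPairs.1 hy).2.2.2.1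
      (mul_left_cancel e)
    exact Prod.ext (congrArg Subtype.val h1) (congrArg Subtype.val h2)
  · rw [SimpleGraph.mem_neighborFinset] at hv
    obtain ⟨i, j, h1, h2, rfl⟩ := exists_of_adj hv
    exact ⟨(i, j), mem_linkPairs.2 ⟨coe_mem_signedPoints i, coe_mem_signedPoints j, h1, h2,
      (adj_mul_pairReflection_iff π h1).1 hv⟩, rfl⟩

theorem degree_le [DecidableRel (hasseDiagram n).Adj] (hn : 5 ≤ n) (π : Hyperoctahedral n) :
    (hasseDiagram n).degree π ≤ n ^ 2 / 2 + n - 1 := by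
  have hc : (positions n).card = n := by simp [positions]
  have := card_linkPairs_le (toInt_neg π) (toInt_injective π) pos_of_mem_positions
    (A := positions n) (by rw [hc]; exact hn)
  rwa [hc, ← degree_eq_card_linkPairs] at this

end Hyperoctahedral

/-! ### A vertex of maximal degree. -/

namespace Hyperoctahedral

variable {n m : ℕ}

/-- The involution of `{±1, …, ±n}` which fixes `±1, …, ±m` and sends `a` to `a - (n + m + 1)` for
`m < a`. -/
def reflectTail (m : ℕ) (a : SignedIndex n) : SignedIndex n :=
  ⟨if (m : ℤ) < a then a - (n + m + 1) else if (a : ℤ) < -m then a + (n + m + 1) else a, by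
    have h1 := a.2.1
    have h2 := abs_le.1 a.2.2
    rw [abs_le]
    split_ifs <;> omega⟩

theorem reflectTail_involutive : Function.Involutive (reflectTail (n := n) m) := fun a => by
  have h1 := a.2.1
  have h2 := abs_le.1 a.2.2
  apply Subtype.ext
  simp only [reflectTail]
  split_ifs <;> omega

/-- The signed permutation `[1, …, m, -n, …, -(m + 1)]`. -/
def tailReflection (n m : ℕ) : Hyperoctahedral n :=
  ⟨(reflectTail_involutive (m := m)).toPerm, fun a => by
    have h1 := a.2.1
    apply Subtype.ext
    simp only [Function.Involutive.coe_toPerm, reflectTail, SignedIndex.coe_neg]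
    split_ifs <;> omega⟩

theorem toInt_tailReflection {k : ℤ} (hk : k ≠ 0 ∧ |k| ≤ (n : ℤ)) :
    toInt (tailReflection n m) k =
      if (m : ℤ) < k then k - (n + m + 1) else if k < -m then k + (n + m + 1) else k :=
  toInt_coe _ ⟨k, hk⟩

/-- In the third case the positions from `i` up to `m` are increasing and so higher than `i`, and
those from `m + 1` up to `j` are lower than `j`, so the box is empty. It misses the origin because
all values beyond `m` are negative. -/
theorem linked_tailReflection {i j : ℤ} (hi : i ≠ 0 ∧ |i| ≤ (n : ℤ))
    (hj : j ≠ 0 ∧ |j| ≤ (n : ℤ)) (h : i = -1 ∧ j = 1 ∨ (0 < i ∧ j = i + 1) ∨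
      (-(m : ℤ) ≤ i ∧ i ≤ m ∧ (m : ℤ) < j)) :
    Linked (toInt (tailReflection n m)) (positions n) i j := by
  have ei := toInt_tailReflection (m := m) hi
  have ej := toInt_tailReflection (m := m) hj
  rw [abs_le] at hi hj
  refine ⟨by omega, ?_, fun k hk hb => ?_⟩
  · unfold Central
    split_ifs at ei ej <;> omega
  · have hk' := mem_signedPoints_positions.1 (mem_signedPoints.2 hk)
    have ek := toInt_tailReflection (m := m) hk'
    rw [abs_le] at hk'
    unfold InBox at hb
    split_ifs at ei ej ek <;> omega

theorem card_linkPairs_tailReflection (hm : m < n) (hm0 : 0 < m) :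
    n - 1 + 2 * m * (n - m) ≤ (linkPairs (toInt (tailReflection n m)) (positions n)).card := by
  -- The adjacent pair `(m, m + 1)` is removed because it already belongs to the product. The total
  -- is `1 + (n - 2) + 2 * m * (n - m)`.
  have hsub : (insert (-1, 1) (((Finset.Icc 1 ((n : ℤ) - 1)).erase m).image fun i => (i, i + 1)) ∪
      ((Finset.Icc (-(m : ℤ)) m).erase 0) ×ˢ Finset.Icc ((m : ℤ) + 1) n : Finset (ℤ × ℤ)) ⊆
        linkPairs (toInt (tailReflection n m)) (positions n) := by
    rintro ⟨i, j⟩ hx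
    simp only [Finset.mem_union, Finset.mem_insert, Finset.mem_image, Finset.mem_product,
      Finset.mem_erase, Finset.mem_Icc, Prod.mk.injEq] at hx
    have hx' : i = -1 ∧ j = 1 ∨ (0 < i ∧ j = i + 1 ∧ j ≤ n) ∨
        (i ≠ 0 ∧ -(m : ℤ) ≤ i ∧ i ≤ m ∧ (m : ℤ) < j ∧ j ≤ n) := by
      rcases hx with (hx | ⟨a, ha, rfl, rfl⟩) | hx <;> omega
    have hi : i ≠ 0 ∧ |i| ≤ (n : ℤ) := by rw [abs_le]; omega
    have hj : j ≠ 0 ∧ |j| ≤ (n : ℤ) := by rw [abs_le]; omega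
    refine mem_linkPairs.2 ⟨mem_signedPoints_positions.2 hi, mem_signedPoints_positions.2 hj,
      ?_, ?_, linked_tailReflection hi hj (by omega)⟩ <;> simp only <;> omega
  refine le_trans (le_of_eq ?_) (Finset.card_le_card hsub)
  rw [Finset.card_union_of_disjoint, Finset.card_insert_of_notMem,
    Finset.card_image_of_injective _ (fun a b e => (Prod.mk.inj e).1), Finset.card_product,
    Finset.card_erase_of_mem, Finset.card_erase_of_mem, Int.card_Icc, Int.card_Icc, Int.card_Icc]
  · have e1 : ((m : ℤ) + 1 - -m).toNat - 1 = 2 * m := by omega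
    have e2 : ((n : ℤ) + 1 - (m + 1)).toNat = n - m := by omega
    rw [e1, e2]
    omega
  · rw [Finset.mem_Icc]; omega
  · rw [Finset.mem_Icc]; omega
  · simp only [Finset.mem_image, Finset.mem_erase, Finset.mem_Icc, Prod.mk.injEq]
    omega
  · rw [Finset.disjoint_left]
    rintro ⟨i, j⟩ h1 h2
    simp only [Finset.mem_insert, Finset.mem_image, Finset.mem_product,
      Finset.mem_erase, Finset.mem_Icc, Prod.mk.injEq] at h1 h2
    rcases h1 with h1 | ⟨a, ha, rfl, rfl⟩ <;> omega

theorem degree_tailReflection [DecidableRel (hasseDiagram n).Adj] (hn : 5 ≤ n) :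
    (hasseDiagram n).degree (tailReflection n (n / 2)) = n ^ 2 / 2 + n - 1 := by
  refine le_antisymm (degree_le hn _) ?_
  rw [degree_eq_card_linkPairs]
  refine le_trans ?_ (card_linkPairs_tailReflection (n := n) (m := n / 2) (by omega) (by omega))
  have key : n ^ 2 / 2 = 2 * (n / 2) * (n - n / 2) := by
    rcases Nat.even_or_odd' n with ⟨k, rfl | rfl⟩
    · have e : 2 * k / 2 = k := by omega
      have e' : 2 * k - k = k := by omega
      rw [e, e', show (2 * k) ^ 2 = 2 * (2 * k * k) by ring]
      omega
    · have e : (2 * k + 1) / 2 = k := by omega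
      have e' : 2 * k + 1 - k = k + 1 := by omega
      rw [e, e', show (2 * k + 1) ^ 2 = 2 * (2 * k * (k + 1)) + 1 by ring]
      omega
  omega

end Hyperoctahedral

/-- For `n ≥ 5` the maximum degree of the Hasse diagram of the Bruhat order of `B_n` is
`⌊n²/2⌋ + n - 1`, and with `m = ⌊n/2⌋` it is attained at the signed permutation
`[1, …, m, -n, -(n-1), …, -(m+1)]`. -/
theorem theorem3p3 (n : ℕ) (hn : 5 ≤ n)
    [DecidableRel (Hyperoctahedral.hasseDiagram n).Adj] :
    (Hyperoctahedral.hasseDiagram n).maxDegree = n ^ 2 / 2 + n - 1 ∧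
    ∃ π : Hyperoctahedral n,
      (∀ i : SignedIndex n, 1 ≤ (i : ℤ) → (i : ℤ) ≤ ((n / 2 : ℕ) : ℤ) →
        ((π.1 i : SignedIndex n) : ℤ) = i) ∧
      (∀ i : SignedIndex n, ((n / 2 : ℕ) : ℤ) < (i : ℤ) →
        ((π.1 i : SignedIndex n) : ℤ) = -((n : ℤ) + ((n / 2 : ℕ) : ℤ) + 1 - (i : ℤ))) ∧
      (Hyperoctahedral.hasseDiagram n).degree π = n ^ 2 / 2 + n - 1 := by
  have hdeg := Hyperoctahedral.degree_tailReflection hn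
  have hval : ∀ i : SignedIndex n,
      (((Hyperoctahedral.tailReflection n (n / 2)).1 i : SignedIndex n) : ℤ) =
        if ((n / 2 : ℕ) : ℤ) < i then (i : ℤ) - (n + (n / 2 : ℕ) + 1)
        else if (i : ℤ) < -(n / 2 : ℕ) then i + (n + (n / 2 : ℕ) + 1) else i := fun _ => rfl
  refine ⟨le_antisymm (SimpleGraph.maxDegree_le_of_forall_degree_le _ _
    (Hyperoctahedral.degree_le hn)) ?_, _, fun i h1 h2 => ?_, fun i h => ?_, hdeg⟩
  · rw [← hdeg]
    exact SimpleGraph.degree_le_maxDegree _ _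
  · rw [hval, if_neg (by omega), if_neg (by omega)]
  · rw [hval, if_pos h]
    ring
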